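/- All graphs are finite and simple. Let $G+H$ denote the disjoint union of graphs $G$ and $H$, $G\oplus H$ their join (the disjoint union together with all edges between $G$ and $H$), $nG$ the disjoint union of $n$ copies of $G$, and $\overline G$ the complement of $G$; $K_n$, $P_n$, $C_n$ are the complete graph, path and cycle on $n$ vertices. The class of cographs is the smallest class of graphs (closed under isomorphism) that contains $K_1$ and is closed under complementation and disjoint union. A cluster is the complement of a complete multipartite graph, and a $k$-cluster is a cluster with at most $k$ connected components. A graph is $(\infty,k)$-polar if its vertex set has a partition $(A,B)$, with $A$ or $B$ possibly empty, such that $A$ induces a complete multipartite graph (with any number of parts) and $B$ induces a $k$-cluster. A cograph minimal $(\infty,k)$-polar obstruction is a cograph that is not $(\infty,k)$-polar but all of whose proper induced subgraphs are $(\infty,k)$-polar; it is of type $(c,i)$ if it has exactly $c$ connected components, exactly $i$ of which are isolated vertices. Let $k\ge 3$ be an integer. A graph $G$ is a cograph minimal $(\infty,k)$-polar obstruction of type $(k,k-1)$ if and only if $G\cong (k-1)K_1+H$, where $H$ is isomorphic to one of the following eight graphs: $$K_1\oplus(C_4+2K_1),\quad K_1\oplus 2P_3,\quad K_1\oplus(K_1+\overline{P_3+K_2}),\quad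 K_1\oplus(K_2+\overline{P_3+K_1}),$$ $$K_2\oplus(K_1+2K_2),\quad K_1\oplus(K_1+K_2+P_3),\quad K_1\oplus(K_1+(K_1\oplus 2K_2)),\quad K_1\oplus((k-1)K_1+2K_2).$$ -/

import Mathlib

open scoped SimpleGraph

namespace CographPolar

universe u v

/-- The join of two graphs: their disjoint union together with all edges between them. -/
def join {V : Type u} {W : Type v} (G : SimpleGraph V) (H : SimpleGraph W) :
    SimpleGraph (V ⊕ W) :=
  (G ⊕g H) ⊔ completeBipartiteGraph V W

/-- `copies n G` is the disjoint union of `n` copies of `G`. -/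
def copies {V : Type u} (n : ℕ) (G : SimpleGraph V) : SimpleGraph (Fin n × V) where
  Adj x y := x.1 = y.1 ∧ G.Adj x.2 y.2
  symm := ⟨fun _ _ h => ⟨h.1.symm, h.2.symm⟩⟩
  loopless := ⟨fun _ h => h.2.ne rfl⟩

/-- The complete graph on `n` vertices. -/
abbrev K (n : ℕ) : SimpleGraph (Fin n) := ⊤

/-- The path on three vertices. -/
abbrev P3 : SimpleGraph (Fin 3) := SimpleGraph.pathGraph 3

/-- The cycle on four vertices. -/
abbrev C4 : SimpleGraph (Fin 4) := SimpleGraph.cycleGraph 4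

/-- Cographs: the smallest isomorphism-closed class of graphs that contains the one-vertex graph
and is closed under complements and disjoint unions. -/
inductive IsCograph : ∀ {V : Type u}, SimpleGraph V → Prop
  | single : IsCograph (⊥ : SimpleGraph PUnit.{u + 1})
  | compl {V : Type u} {G : SimpleGraph V} : IsCograph G → IsCograph Gᶜ
  | sum {V W : Type u} {G : SimpleGraph V} {H : SimpleGraph W} :
      IsCograph G → IsCograph H → IsCograph (G ⊕g H)
  | iso {V W : Type u} {G : SimpleGraph V} {H : SimpleGraph W} :
      G ≃g H → IsCograph G → IsCograph H

/-- `G` is a complete multipartite graph with at most `s` (nonempty) parts; the parts are the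
classes of the non-adjacency relation. For `s = ⊤` the number of parts is unrestricted. -/
def IsCompletePartite {V : Type u} (s : ℕ∞) (G : SimpleGraph V) : Prop :=
  ∃ h : G.IsCompleteMultipartite, ENat.card (Quotient h.setoid) ≤ s

/-- `G` is a `k`-cluster: the complement of a complete multipartite graph, with at most `k`
connected components. For `k = ⊤` the number of components is unrestricted. -/
def IsCluster {V : Type u} (k : ℕ∞) (G : SimpleGraph V) : Prop :=
  Gᶜ.IsCompleteMultipartite ∧ ENat.card G.ConnectedComponent ≤ k

/-- `G` has an `(s, k)`-polar partition `(A, B)`. Either side may be empty. -/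
def IsPolar {V : Type u} (s k : ℕ∞) (G : SimpleGraph V) : Prop :=
  ∃ A B : Set V, Disjoint A B ∧ A ∪ B = Set.univ ∧
    IsCompletePartite s (G.induce A) ∧ IsCluster k (G.induce B)

/-- `G` is a cograph minimal `(s, k)`-polar obstruction. -/
def IsCographMinObstruction {V : Type u} (s k : ℕ∞) (G : SimpleGraph V) : Prop :=
  IsCograph G ∧ ¬ IsPolar s k G ∧ ∀ S : Set V, S ≠ Set.univ → IsPolar s k (G.induce S)

/-- `G` has exactly `c` connected components, exactly `i` of which are trivial, that is,
isolated vertices. -/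
def HasComponentType {V : Type u} (c i : ℕ) (G : SimpleGraph V) : Prop :=
  ENat.card G.ConnectedComponent = c ∧
    {C : G.ConnectedComponent | C.supp.encard = 1}.encard = i

end CographPolar

open CographPolar

namespace CographPolar

universe u v

/-! Write `G = (k-1)K₁ + L`, with `L` the nontrivial component. In a polar partition `(A, B)` of
`G`, suppose first that `A` contains an edge. Then `A` contains no isolated vertex, which would be
nonadjacent to both ends; the isolated vertices use up `k - 1` cliques of `B`, so `L` is `(∞,
1)`-polar. If instead `A` is independent, it may absorb all isolated vertices, and `L` is an
independent set plus a `k`-cluster. So `G` is not polar exactly when `L` has neither kind of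
partition. `Critical` adds to these two conditions the partitions needed after each vertex deletion.
Seven of the eight graphs have seven vertices and are checked by computation; the one depending on
`k` is `critical_fan`.

Conversely, it suffices to find one of the eight graphs inside `L`, since minimality of `G` then
forces equality (`iso_of_embedding`). As `(∞, 1)`-polarity is preserved by joins, a minimal non-`(∞,
1)`-polar set `X` that is completely joined to a nonempty complement is disconnected. A vertex
outside `X` supplies the factor `K₁`.

If `X` is a cluster, it contains `2K₂` and a third component. With more than `k` components it
contains `(k-1)K₁ + 2K₂`. Otherwise it is a `k`-cluster, so its complement is not independent, and
an edge there gives `K₂ ⊕ (K₁ + 2K₂)` (`exists_obstruction_of_cluster`).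

If `X` contains a `P₃`, one compares its component with the rest of `X`. A non-split cograph
contains `C₄` or `2K₂`; a `2K₂` or co-`P₃` inside a component has a vertex adjacent to all of it;
and a cograph containing both `C₄` and co-`P₃` contains `C₄ + K₁` or the complement of `P₃ + K₂`.
These facts yield the other six graphs (`exists_obstruction_of_P3`). -/

/-! ### Polar partitions expressed by colourings -/

/-- The vertices of `A` induce a complete multipartite graph. -/
def MultipartiteOn {V : Type*} (G : SimpleGraph V) (A : Set V) : Prop :=
  ∀ a ∈ A, ∀ b ∈ A, ∀ c ∈ A, ¬ G.Adj a b → ¬ G.Adj b c → ¬ G.Adj a c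

/-- The vertices of `B` induce a cluster whose cliques are the classes of the colouring `f`. -/
def ClusterOn {V ι : Type*} (G : SimpleGraph V) (f : V → ι) (B : Set V) : Prop :=
  ∀ a ∈ B, ∀ b ∈ B, G.Adj a b ↔ a ≠ b ∧ f a = f b

theorem isCluster_iff {V : Type*} (G : SimpleGraph V) (k : ℕ) :
    IsCluster (k : ℕ∞) G ↔ ∃ f : V → Fin k, ∀ a b, G.Adj a b ↔ a ≠ b ∧ f a = f b := by
  constructor
  · rintro ⟨h, hc⟩
    have hfin : Finite G.ConnectedComponent :=
      ENat.card_lt_top.1 (lt_of_le_of_lt hc (ENat.natCast_lt_top k))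
    have hc' : Nat.card G.ConnectedComponent ≤ k := by
      rw [ENat.card_eq_coe_natCard] at hc; exact_mod_cast hc
    have e := Finite.equivFin G.ConnectedComponent
    refine ⟨fun v => Fin.castLE hc' (e (G.connectedComponentMk v)), fun a b => ⟨fun hab =>
      ⟨hab.ne, by simp only [SimpleGraph.ConnectedComponent.connectedComponentMk_eq_of_adj hab]⟩, ?_⟩⟩
    rintro ⟨hne, hab⟩
    have hr : G.Reachable a b := by
      have := e.injective (Fin.castLE_injective hc' hab)
      exact SimpleGraph.ConnectedComponent.exact this
    -- Since the complement is complete multipartite, "equal or adjacent" is transitive, hence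
    -- passes along walks.
    have key : ∀ x y, G.Walk x y → x = y ∨ G.Adj x y := by
      intro x y w
      induction w with
      | nil => exact Or.inl rfl
      | @cons x y z hxy _ ih =>
        by_contra hxz
        push Not at hxz
        exact h.trans x y z (by simp [hxy]) (by rcases ih with rfl | h <;> simp [*])
          ((SimpleGraph.compl_adj _ _ _).2 hxz)
    exact hr.elim fun w => (key a b w).resolve_left hne
  · rintro ⟨f, hf⟩
    refine ⟨⟨fun a b c hab hbc hac => ?_⟩, ?_⟩
    · grind [SimpleGraph.compl_adj]
    · have hlift : ∀ a b, G.Walk a b → f a = f b := by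
        intro a b w
        induction w with
        | nil => rfl
        | cons h _ ih => exact ((hf _ _).1 h).2.trans ih
      let g : G.ConnectedComponent → Fin k :=
        SimpleGraph.ConnectedComponent.lift f (fun a b w _ => hlift a b w)
      have hg : Function.Injective g := by
        intro C D
        induction C using SimpleGraph.ConnectedComponent.ind with | _ a
        induction D using SimpleGraph.ConnectedComponent.ind with | _ b
        intro h
        by_cases hab : a = b
        · rw [hab]
        · exact SimpleGraph.ConnectedComponent.connectedComponentMk_eq_of_adj
            ((hf a b).2 ⟨hab, h⟩)
      simpa using ENat.card_le_card_of_injective hg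

/-- The subgraph induced on `S` is `(∞, k)`-polar, with the `k`-cluster given by a colouring. -/
def PolarOn {V : Type*} (k : ℕ) (G : SimpleGraph V) (S : Set V) : Prop :=
  ∃ (A : Set V) (f : V → Fin k), MultipartiteOn G (S ∩ A) ∧ ClusterOn G f (S \ A)

theorem PolarOn.comap {V W : Type*} {k : ℕ} {G : SimpleGraph V} {H : SimpleGraph W} {S : Set W}
    {T : Set V} (h : PolarOn k H S) (φ : G ↪g H) (hT : ∀ x ∈ T, φ x ∈ S) : PolarOn k G T := by
  obtain ⟨A, f, hA, hB⟩ := h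
  refine ⟨φ ⁻¹' A, f ∘ φ, fun a ha b hb c hc => ?_, fun a ha b hb => ?_⟩
  · simpa using hA (φ a) ⟨hT _ ha.1, ha.2⟩ (φ b) ⟨hT _ hb.1, hb.2⟩ (φ c) ⟨hT _ hc.1, hc.2⟩
  · simpa using hB (φ a) ⟨hT _ ha.1, ha.2⟩ (φ b) ⟨hT _ hb.1, hb.2⟩

theorem isPolar_iff {V : Type*} (G : SimpleGraph V) {k : ℕ} (hk : 0 < k) :
    IsPolar ⊤ (k : ℕ∞) G ↔ PolarOn k G Set.univ := by
  classical
  constructor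
  · rintro ⟨A, B, hd, hu, ⟨hA, -⟩, hB⟩
    obtain ⟨f, hf⟩ := (isCluster_iff _ _).1 hB
    have hmem : ∀ {x}, x ∉ A → x ∈ B := fun {x} hx =>
      ((hu ▸ Set.mem_univ x : x ∈ A ∪ B)).resolve_left hx
    -- Colours off `B` are irrelevant; the default `0` is where `0 < k` is needed.
    refine ⟨A, fun v => if h : v ∈ B then f ⟨v, h⟩ else ⟨0, hk⟩, ?_, ?_⟩
    · rintro a ⟨-, ha⟩ b ⟨-, hb⟩ c ⟨-, hc⟩ hab hbc
      exact hA.trans ⟨a, ha⟩ ⟨b, hb⟩ ⟨c, hc⟩ hab hbc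
    · rintro a ⟨-, ha⟩ b ⟨-, hb⟩
      have := hf ⟨a, hmem ha⟩ ⟨b, hmem hb⟩
      simpa [hmem ha, hmem hb] using this
  · rintro ⟨A, f, hA, hB⟩
    refine ⟨A, Aᶜ, disjoint_compl_right, Set.union_compl_self A, ⟨⟨?_⟩, le_top⟩,
      (isCluster_iff _ _).2 ⟨fun v => f v, fun a b => ?_⟩⟩
    · rintro ⟨a, ha⟩ ⟨b, hb⟩ ⟨c, hc⟩ hab hbc
      exact hA a ⟨trivial, ha⟩ b ⟨trivial, hb⟩ c ⟨trivial, hc⟩ hab hbc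
    · have := hB a ⟨trivial, a.2⟩ b ⟨trivial, b.2⟩
      simpa [Subtype.ext_iff] using this

theorem isPolar_induce_iff {V : Type*} (G : SimpleGraph V) (S : Set V) {k : ℕ} (hk : 0 < k) :
    IsPolar ⊤ (k : ℕ∞) (G.induce S) ↔ PolarOn k G S := by
  classical
  rw [isPolar_iff _ hk]
  constructor
  · rintro ⟨A, f, hA, hB⟩
    refine ⟨Subtype.val '' A, fun v => if h : v ∈ S then f ⟨v, h⟩ else ⟨0, hk⟩, ?_, ?_⟩
    · rintro _ ⟨-, a, ha, rfl⟩ _ ⟨-, b, hb, rfl⟩ _ ⟨-, c, hc, rfl⟩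
      exact hA a ⟨trivial, ha⟩ b ⟨trivial, hb⟩ c ⟨trivial, hc⟩
    · rintro a ⟨ha, ha'⟩ b ⟨hb, hb'⟩
      have := hB ⟨a, ha⟩ ⟨trivial, fun h => ha' ⟨_, h, rfl⟩⟩ ⟨b, hb⟩
        ⟨trivial, fun h => hb' ⟨_, h, rfl⟩⟩
      simpa [ha, hb] using this
  · intro h
    exact h.comap (SimpleGraph.Embedding.induce S) (fun x _ => x.2)

/-! ### Cographs through their join and union decompositions -/

/-- Every vertex set with at least two elements splits into two nonempty parts with all or no
edges between them. -/
def Decomposable {V : Type*} (G : SimpleGraph V) : Prop :=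
  ∀ S : Set V, S.Nontrivial → ∃ P Q : Set V, P.Nonempty ∧ Q.Nonempty ∧ Disjoint P Q ∧ P ∪ Q = S ∧
    ((∀ p ∈ P, ∀ q ∈ Q, G.Adj p q) ∨ ∀ p ∈ P, ∀ q ∈ Q, ¬ G.Adj p q)

theorem Decomposable.comap {V W : Type*} {G : SimpleGraph V} {H : SimpleGraph W}
    (h : Decomposable H) (φ : G ↪g H) : Decomposable G := by
  intro S hS
  obtain ⟨P, Q, ⟨p, hp⟩, ⟨q, hq⟩, hd, hu, hPQ⟩ := h (φ '' S) (hS.image φ.injective)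
  have hP : ∃ x, φ x ∈ P := by
    obtain ⟨x, -, rfl⟩ : p ∈ φ '' S := hu ▸ Or.inl hp
    exact ⟨x, hp⟩
  have hQ : ∃ x, φ x ∈ Q := by
    obtain ⟨x, -, rfl⟩ : q ∈ φ '' S := hu ▸ Or.inr hq
    exact ⟨x, hq⟩
  refine ⟨φ ⁻¹' P, φ ⁻¹' Q, hP, hQ, hd.preimage φ, ?_, ?_⟩
  · rw [← Set.preimage_union, hu, Set.preimage_image_eq _ φ.injective]
  · simp only [Set.mem_preimage]
    rcases hPQ with h | h
    · exact Or.inl fun p hp q hq => by simpa using h _ hp _ hq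
    · exact Or.inr fun p hp q hq => by simpa using h _ hp _ hq

theorem IsCograph.decomposable {V : Type u} {G : SimpleGraph V} (h : IsCograph G) :
    Decomposable G := by
  induction h with
  | single => exact fun S hS => (hS.not_subsingleton Set.subsingleton_of_subsingleton).elim
  | compl _ ih =>
    intro S hS
    obtain ⟨P, Q, hP, hQ, hd, hu, h⟩ := ih S hS
    refine ⟨P, Q, hP, hQ, hd, hu, h.symm.imp (fun h p hp q hq => ?_) (fun h p hp q hq => ?_)⟩
    · rw [SimpleGraph.compl_adj]
      exact ⟨hd.ne_of_mem hp hq, h p hp q hq⟩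
    · rw [SimpleGraph.compl_adj]
      exact fun h' => h'.2 (h p hp q hq)
  | @sum V W G H _ _ ihG ihH =>
    intro S hS
    by_cases h1 : ∃ x, Sum.inl x ∈ S
    · by_cases h2 : ∃ x, Sum.inr x ∈ S
      · refine ⟨S ∩ Set.range Sum.inl, S ∩ Set.range Sum.inr, ?_, ?_, ?_, ?_, Or.inr ?_⟩
        · obtain ⟨x, hx⟩ := h1; exact ⟨_, hx, x, rfl⟩
        · obtain ⟨x, hx⟩ := h2; exact ⟨_, hx, x, rfl⟩
        · exact (Set.isCompl_range_inl_range_inr.disjoint).mono Set.inter_subset_right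
            Set.inter_subset_right
        · rw [← Set.inter_union_distrib_left, Set.range_inl_union_range_inr, Set.inter_univ]
        · rintro _ ⟨-, x, rfl⟩ _ ⟨-, y, rfl⟩
          simp
      · have hS' : S = Sum.inl '' (Sum.inl ⁻¹' S) := by
          ext x; rcases x with x | x <;> grind
        rw [hS'] at hS ⊢
        obtain ⟨P, Q, hP, hQ, hd, hu, h⟩ := ihG _ (Set.nontrivial_of_image _ _ hS)
        refine ⟨Sum.inl '' P, Sum.inl '' Q, hP.image _, hQ.image _,
          (Set.disjoint_image_iff Sum.inl_injective).2 hd, by rw [← Set.image_union, hu], ?_⟩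
        simpa using h
    · have hS' : S = Sum.inr '' (Sum.inr ⁻¹' S) := by
        ext x; rcases x with x | x <;> grind
      rw [hS'] at hS ⊢
      obtain ⟨P, Q, hP, hQ, hd, hu, h⟩ := ihH _ (Set.nontrivial_of_image _ _ hS)
      refine ⟨Sum.inr '' P, Sum.inr '' Q, hP.image _, hQ.image _,
        (Set.disjoint_image_iff Sum.inr_injective).2 hd, by rw [← Set.image_union, hu], ?_⟩
      simpa using h
  | iso e _ ih => exact ih.comap e.symm.toEmbedding

/-- Graphs satisfying `Decomposable` have no induced path on four vertices. -/
theorem Decomposable.no_path {V : Type*} {G : SimpleGraph V} (h : Decomposable G) {a b c d : V}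
    (hab : G.Adj a b) (hbc : G.Adj b c) (hcd : G.Adj c d) (hac : ¬ G.Adj a c)
    (hbd : ¬ G.Adj b d) (had : ¬ G.Adj a d) : False := by
  obtain ⟨P, Q, ⟨p, hp⟩, ⟨q, hq⟩, hd, hu, hPQ⟩ := h {a, b, c, d}
    ⟨a, by simp, b, by simp, hab.ne⟩
  have hm : ∀ x, (x ∈ P ∨ x ∈ Q) ↔ (x = a ∨ x = b ∨ x = c ∨ x = d) := by
    intro x; simpa using Set.ext_iff.1 hu x
  have hda := (hm a).2 (by simp)
  have hdb := (hm b).2 (by simp)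
  have hdc := (hm c).2 (by simp)
  have hdd := (hm d).2 (by simp)
  have hpm := (hm p).1 (Or.inl hp)
  have hqm := (hm q).1 (Or.inr hq)
  have hdis : ∀ x, x ∈ P → x ∈ Q → False := fun x h1 h2 => Set.disjoint_left.1 hd h1 h2
  have hs : ∀ x y, G.Adj x y → G.Adj y x := fun x y h => h.symm
  rcases hPQ with h | h <;> grind

/-! ### Assembling induced copies of sums, joins and small graphs -/

/-- `L` is an induced subgraph of `G` on vertices of `S`. -/
def EmbedsIn {W V : Type*} (L : SimpleGraph W) (G : SimpleGraph V) (S : Set V) : Prop :=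
  ∃ f : W → V, Function.Injective f ∧ (∀ x y, G.Adj (f x) (f y) ↔ L.Adj x y) ∧ ∀ x, f x ∈ S

@[simp] theorem join_adj_inl_inl {V W : Type*} (G : SimpleGraph V) (H : SimpleGraph W) (a b : V) :
    (join G H).Adj (Sum.inl a) (Sum.inl b) ↔ G.Adj a b := by simp [join]

@[simp] theorem join_adj_inr_inr {V W : Type*} (G : SimpleGraph V) (H : SimpleGraph W) (a b : W) :
    (join G H).Adj (Sum.inr a) (Sum.inr b) ↔ H.Adj a b := by simp [join]

@[simp] theorem join_adj_inl_inr {V W : Type*} (G : SimpleGraph V) (H : SimpleGraph W) (a : V)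
    (b : W) : (join G H).Adj (Sum.inl a) (Sum.inr b) := by simp [join]

@[simp] theorem join_adj_inr_inl {V W : Type*} (G : SimpleGraph V) (H : SimpleGraph W) (a : W)
    (b : V) : (join G H).Adj (Sum.inr a) (Sum.inl b) := by simp [join]

@[simp] theorem copies_adj {V : Type*} (n : ℕ) (G : SimpleGraph V) (x y : Fin n × V) :
    (copies n G).Adj x y ↔ x.1 = y.1 ∧ G.Adj x.2 y.2 := Iff.rfl

section
variable {V W₁ W₂ : Type*} {G : SimpleGraph V} {L₁ : SimpleGraph W₁} {L₂ : SimpleGraph W₂}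
  {S T : Set V}

theorem EmbedsIn.nonempty (h : EmbedsIn L₁ G S) : Nonempty (L₁ ↪g G) :=
  let ⟨f, hi, ha, _⟩ := h
  ⟨⟨⟨f, hi⟩, ha _ _⟩⟩

theorem EmbedsIn.sum (h₁ : EmbedsIn L₁ G S) (h₂ : EmbedsIn L₂ G T)
    (h : ∀ a ∈ S, ∀ b ∈ T, a ≠ b ∧ ¬ G.Adj a b) : EmbedsIn (L₁ ⊕g L₂) G (S ∪ T) := by
  obtain ⟨f, hfi, hfa, hf⟩ := h₁
  obtain ⟨g, hgi, hga, hg⟩ := h₂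
  have h' : ∀ x y, f x ≠ g y ∧ ¬ G.Adj (f x) (g y) := fun x y => h _ (hf x) _ (hg y)
  have h'' : ∀ x y, g y ≠ f x ∧ ¬ G.Adj (g y) (f x) := fun x y =>
    ⟨(h' x y).1.symm, fun e => (h' x y).2 e.symm⟩
  refine ⟨Sum.elim f g, ?_, ?_, ?_⟩
  · rintro (x | x) (y | y) <;> simp [h', h'', hfi.eq_iff, hgi.eq_iff]
  · rintro (x | x) (y | y) <;> simp [h', h'', hfa, hga]
  · rintro (x | x)
    · exact Or.inl (hf x)
    · exact Or.inr (hg x)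

theorem EmbedsIn.join (h₁ : EmbedsIn L₁ G S) (h₂ : EmbedsIn L₂ G T)
    (h : ∀ a ∈ S, ∀ b ∈ T, G.Adj a b) : EmbedsIn (join L₁ L₂) G (S ∪ T) := by
  obtain ⟨f, hfi, hfa, hf⟩ := h₁
  obtain ⟨g, hgi, hga, hg⟩ := h₂
  have h' : ∀ x y, f x ≠ g y ∧ G.Adj (f x) (g y) := fun x y =>
    ⟨(h _ (hf x) _ (hg y)).ne, h _ (hf x) _ (hg y)⟩
  have h'' : ∀ x y, g y ≠ f x ∧ G.Adj (g y) (f x) := fun x y =>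
    ⟨(h' x y).1.symm, (h' x y).2.symm⟩
  refine ⟨Sum.elim f g, ?_, ?_, ?_⟩
  · rintro (x | x) (y | y) <;> simp [h', h'', hfi.eq_iff, hgi.eq_iff]
  · rintro (x | x) (y | y) <;> simp [h', h'', hfa, hga]
  · rintro (x | x)
    · exact Or.inl (hf x)
    · exact Or.inr (hg x)

theorem EmbedsIn.copies_two (h₁ : EmbedsIn L₁ G S) (h₂ : EmbedsIn L₁ G T)
    (h : ∀ a ∈ S, ∀ b ∈ T, a ≠ b ∧ ¬ G.Adj a b) : EmbedsIn (copies 2 L₁) G (S ∪ T) := by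
  obtain ⟨f, hfi, hfa, hf⟩ := h₁.sum h₂ h
  have hi : Function.Injective
      (fun x : Fin 2 × W₁ => (if x.1 = 0 then Sum.inl x.2 else Sum.inr x.2 : W₁ ⊕ W₁)) := by
    rintro ⟨i, x⟩ ⟨j, y⟩
    fin_cases i <;> fin_cases j <;> simp
  refine ⟨_, hfi.comp hi, ?_, fun x => hf _⟩
  rintro ⟨i, x⟩ ⟨j, y⟩
  fin_cases i <;> fin_cases j <;> simp [hfa]

theorem EmbedsIn.compl (h : EmbedsIn L₁ Gᶜ S) : EmbedsIn L₁ᶜ G S := by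
  obtain ⟨f, hfi, hfa, hf⟩ := h
  refine ⟨f, hfi, fun x y => ?_, hf⟩
  have h1 := hfa x y
  have h2 := hfi.ne_iff (x := x) (y := y)
  rw [SimpleGraph.compl_adj] at *
  have h3 := G.ne_of_adj (a := f x) (b := f y)
  tauto

theorem embedsIn_K1 (a : V) : EmbedsIn (K 1) G {a} :=
  ⟨fun _ => a, Function.injective_of_subsingleton _, by simp, fun _ => rfl⟩

theorem embedsIn_K2 {a b : V} (h : G.Adj a b) : EmbedsIn (K 2) G {a, b} := by
  refine ⟨![a, b], ?_, ?_, ?_⟩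
  · intro i j
    fin_cases i <;> fin_cases j <;> simp [h.ne, h.ne.symm]
  · intro i j
    fin_cases i <;> fin_cases j <;> simp [h, h.symm]
  · intro i
    fin_cases i <;> simp

theorem embedsIn_P3 {a b c : V} (hab : G.Adj a b) (hbc : G.Adj b c) (hac : ¬ G.Adj a c)
    (hne : a ≠ c) : EmbedsIn P3 G {a, b, c} := by
  have hca : ¬ G.Adj c a := fun h => hac h.symm
  refine ⟨![a, b, c], ?_, ?_, ?_⟩
  · intro i j
    fin_cases i <;> fin_cases j <;> simp [hab.ne, hab.ne.symm, hbc.ne, hbc.ne.symm, hne, hne.symm]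
  · intro i j
    fin_cases i <;> fin_cases j <;>
      simp [SimpleGraph.pathGraph_adj, hab, hab.symm, hbc, hbc.symm, hac, hca]
  · intro i
    fin_cases i <;> simp

theorem C4_adj : ∀ i j : Fin 4, C4.Adj i j ↔ (i.val + j.val) % 2 = 1 := by
  decide

theorem embedsIn_C4 {a b c d : V} (hab : G.Adj a b) (hbc : G.Adj b c) (hcd : G.Adj c d)
    (hda : G.Adj d a) (hac : ¬ G.Adj a c) (hbd : ¬ G.Adj b d) (hac' : a ≠ c) (hbd' : b ≠ d) :
    EmbedsIn C4 G {a, b, c, d} := by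
  have hca : ¬ G.Adj c a := fun h => hac h.symm
  have hdb : ¬ G.Adj d b := fun h => hbd h.symm
  refine ⟨![a, b, c, d], ?_, ?_, ?_⟩
  · intro i j
    fin_cases i <;> fin_cases j <;> simp [hab.ne, hab.ne.symm, hbc.ne, hbc.ne.symm, hac', hac'.symm,
      hbd', hbd'.symm, hcd.ne, hcd.ne.symm, hda.ne, hda.ne.symm]
  · intro i j
    fin_cases i <;> fin_cases j <;>
      simp [C4_adj, hab, hab.symm, hbc, hbc.symm, hac, hca, hbd, hdb, hcd,
        hcd.symm, hda, hda.symm]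
  · intro i
    fin_cases i <;> simp

theorem embedsIn_copies_K1 {n : ℕ} {ι : Fin n → V} (hι : Function.Injective ι)
    (h : ∀ i j, ¬ G.Adj (ι i) (ι j)) : EmbedsIn (copies n (K 1)) G (Set.range ι) := by
  refine ⟨fun x => ι x.1, ?_, ?_, fun x => ⟨x.1, rfl⟩⟩
  · rintro ⟨i, x⟩ ⟨j, y⟩ hij
    obtain rfl : i = j := hι hij
    simp [Subsingleton.elim x y]
  · rintro ⟨i, x⟩ ⟨j, y⟩
    simp [h, Subsingleton.elim x y]

end

/-! ### Split sets, components and forced subgraphs in cographs -/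

section
variable {V : Type*} {G : SimpleGraph V}

/-- `a b c d` is an induced four-cycle. -/
def IsC4 (G : SimpleGraph V) (a b c d : V) : Prop :=
  G.Adj a b ∧ G.Adj b c ∧ G.Adj c d ∧ G.Adj d a ∧ ¬ G.Adj a c ∧ ¬ G.Adj b d ∧ a ≠ c ∧ b ≠ d

/-- `a b` and `c d` are the edges of an induced `2K₂`. -/
def IsTwoK2 (G : SimpleGraph V) (a b c d : V) : Prop :=
  G.Adj a b ∧ G.Adj c d ∧ ¬ G.Adj a c ∧ ¬ G.Adj a d ∧ ¬ G.Adj b c ∧ ¬ G.Adj b d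

/-- `S` is the disjoint union of an independent set and a clique. -/
def SplitOn (G : SimpleGraph V) (S : Set V) : Prop :=
  ∃ A ⊆ S, (∀ a ∈ A, ∀ b ∈ A, ¬ G.Adj a b) ∧ ∀ a ∈ S, ∀ b ∈ S, a ∉ A → b ∉ A → a ≠ b → G.Adj a b

/-- Induction on the decomposition. In a join of split sets, a clique side can be added to the other
side's clique; if neither side is a clique, two nonadjacent pairs form a `C₄`. The case of a union
is dual and produces `2K₂`. -/
theorem Decomposable.splitOn [Finite V] (h : Decomposable G) (S : Set V) :
    SplitOn G S ∨ (∃ a ∈ S, ∃ b ∈ S, ∃ c ∈ S, ∃ d ∈ S, IsC4 G a b c d) ∨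
      ∃ a ∈ S, ∃ b ∈ S, ∃ c ∈ S, ∃ d ∈ S, IsTwoK2 G a b c d := by
  induction S using WellFoundedLT.induction with | _ S ih
  by_cases hS : S.Nontrivial
  swap
  · refine Or.inl ⟨S, subset_rfl, fun a ha b hb hab => hS ⟨a, ha, b, hb, hab.ne⟩, ?_⟩
    intro a ha b _ ha'
    exact (ha' ha).elim
  obtain ⟨P, Q, hP, hQ, hd, rfl, hPQ⟩ := h S hS
  have hd' := Set.disjoint_left.1 hd
  obtain ⟨p, hp⟩ := hP
  obtain ⟨q, hq⟩ := hQ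
  have hPs : P ⊂ P ∪ Q := ⟨Set.subset_union_left, fun hs => hd' (hs (.inr hq)) hq⟩
  have hQs : Q ⊂ P ∪ Q := ⟨Set.subset_union_right, fun hs => hd' hp (hs (.inl hp))⟩
  by_contra hcon
  push Not at hcon
  obtain ⟨hsplit, hC4, hK2⟩ := hcon
  have ihP : SplitOn G P := by
    rcases ih P hPs with h | h | h
    · exact h
    · obtain ⟨a, ha, b, hb, c, hc, d, hd, h⟩ := h
      exact (hC4 a (.inl ha) b (.inl hb) c (.inl hc) d (.inl hd) h).elim
    · obtain ⟨a, ha, b, hb, c, hc, d, hd, h⟩ := h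
      exact (hK2 a (.inl ha) b (.inl hb) c (.inl hc) d (.inl hd) h).elim
  have ihQ : SplitOn G Q := by
    rcases ih Q hQs with h | h | h
    · exact h
    · obtain ⟨a, ha, b, hb, c, hc, d, hd, h⟩ := h
      exact (hC4 a (.inr ha) b (.inr hb) c (.inr hc) d (.inr hd) h).elim
    · obtain ⟨a, ha, b, hb, c, hc, d, hd, h⟩ := h
      exact (hK2 a (.inr ha) b (.inr hb) c (.inr hc) d (.inr hd) h).elim
  obtain ⟨A, hAP, hA, hA'⟩ := ihP
  obtain ⟨B, hBQ, hB, hB'⟩ := ihQ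
  have hs : ∀ x y, G.Adj x y → G.Adj y x := fun x y h => h.symm
  rcases hPQ with h | h
  · by_cases hQc : ∀ a ∈ Q, ∀ b ∈ Q, a ≠ b → G.Adj a b
    · exact hsplit ⟨A, hAP.trans Set.subset_union_left, hA, by grind⟩
    · by_cases hPc : ∀ a ∈ P, ∀ b ∈ P, a ≠ b → G.Adj a b
      · exact hsplit ⟨B, hBQ.trans Set.subset_union_right, hB, by grind⟩
      · push Not at hPc hQc
        obtain ⟨a, ha, c, hc, hac, hac'⟩ := hPc
        obtain ⟨b, hb, d, hd, hbd, hbd'⟩ := hQc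
        exact hC4 a (.inl ha) b (.inr hb) c (.inl hc) d (.inr hd) ⟨h a ha b hb,
          (h c hc b hb).symm, h c hc d hd, (h a ha d hd).symm, hac', hbd', hac, hbd⟩
  · by_cases hQc : ∀ a ∈ Q, ∀ b ∈ Q, ¬ G.Adj a b
    · exact hsplit ⟨A ∪ Q, Set.union_subset_union_left _ hAP, by grind, by grind⟩
    · by_cases hPc : ∀ a ∈ P, ∀ b ∈ P, ¬ G.Adj a b
      · exact hsplit ⟨P ∪ B, Set.union_subset_union_right _ hBQ, by grind, by grind⟩
      · push Not at hPc hQc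
        obtain ⟨a, ha, b, hb, hab⟩ := hPc
        obtain ⟨c, hc, d, hd, hcd⟩ := hQc
        exact hK2 a (.inl ha) b (.inl hb) c (.inr hc) d (.inr hd)
          ⟨hab, hcd, h a ha c hc, h a ha d hd, h b hb c hc, h b hb d hd⟩

/-- Two vertices are at distance at most two. -/
def Near (G : SimpleGraph V) (a b : V) : Prop :=
  a = b ∨ G.Adj a b ∨ ∃ c, G.Adj a c ∧ G.Adj c b

theorem Near.symm {a b : V} : Near G a b → Near G b a := by
  rintro (h | h | ⟨c, h, h'⟩)
  · exact Or.inl h.symm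
  · exact Or.inr (Or.inl h.symm)
  · exact Or.inr (Or.inr ⟨c, h'.symm, h.symm⟩)

/-- In a `P₄`-free graph, shortest paths have at most two edges. `Near` is therefore the relation of
lying in one component. -/
theorem Near.step (hG : Decomposable G) {a b c : V} (h : Near G a b) (hbc : G.Adj b c) :
    Near G a c := by
  rcases h with rfl | h | ⟨x, h, h'⟩
  · exact Or.inr (Or.inl hbc)
  · exact Or.inr (Or.inr ⟨b, h, hbc⟩)
  · by_cases hab : G.Adj a b
    · exact Or.inr (Or.inr ⟨b, hab, hbc⟩)
    · by_cases hxc : G.Adj x c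
      · exact Or.inr (Or.inr ⟨x, h, hxc⟩)
      · by_cases hac : G.Adj a c
        · exact Or.inr (Or.inl hac)
        · exact (hG.no_path h h' hbc hab hxc hac).elim

theorem Near.trans (hG : Decomposable G) {a b c : V} (h : Near G a b) (h' : Near G b c) :
    Near G a c := by
  rcases h' with rfl | h' | ⟨x, h1, h2⟩
  · exact h
  · exact h.step hG h'
  · exact (h.step hG h1).step hG h2

/-- A common neighbour of `a` and `c` that missed `b` or `d` would be an inner vertex of an induced
`P₄`. -/
theorem IsTwoK2.exists_dominating (hG : Decomposable G) {a b c d : V} (h : IsTwoK2 G a b c d)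
    (hn : Near G a c) : ∃ u, G.Adj u a ∧ G.Adj u b ∧ G.Adj u c ∧ G.Adj u d := by
  obtain ⟨hab, hcd, hac, had, hbc, hbd⟩ := h
  rcases hn with rfl | h | ⟨u, hu, hu'⟩
  · exact (had hcd).elim
  · exact (hac h).elim
  · refine ⟨u, hu.symm, ?_, hu', ?_⟩
    · by_contra hub
      exact hG.no_path hab.symm hu hu' (fun h => hub h.symm) hac hbc
    · by_contra hud
      exact hG.no_path hu hu' hcd hac hud had

theorem Decomposable.exists_paw (hG : Decomposable G) {a b c : V} (hab : ¬ G.Adj a b)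
    (hbc : ¬ G.Adj b c) (hac : G.Adj a c) (hn : Near G b a) :
    ∃ u, G.Adj u a ∧ G.Adj u b ∧ G.Adj u c := by
  rcases hn with rfl | h | ⟨u, hu, hu'⟩
  · exact (hbc hac).elim
  · exact (hab h.symm).elim
  · refine ⟨u, hu', hu.symm, ?_⟩
    by_contra huc
    exact hG.no_path hu hu' hac (fun h => hab h.symm) huc hbc

/-- The whole co-`P₃` lies on one side of a join. If the other side has a nonadjacent pair, the
second alternative holds; if it is a clique, the `C₄` lies with the co-`P₃` and induction applies.
In a disjoint union, the `C₄` lies on one side and any vertex of the other serves as `w`. -/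
theorem Decomposable.C4_and_coP3 [Finite V] (hG : Decomposable G) (S : Set V)
    (h4 : ∃ a ∈ S, ∃ b ∈ S, ∃ c ∈ S, ∃ d ∈ S, IsC4 G a b c d)
    (h3 : ∃ a ∈ S, ∃ b ∈ S, ∃ c ∈ S, ¬ G.Adj a b ∧ ¬ G.Adj b c ∧ G.Adj a c) :
    (∃ a ∈ S, ∃ b ∈ S, ∃ c ∈ S, ∃ d ∈ S, ∃ w ∈ S, IsC4 G a b c d ∧
      ∀ x ∈ ({a, b, c, d} : Set V), x ≠ w ∧ ¬ G.Adj x w) ∨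
    ∃ a ∈ S, ∃ b ∈ S, ∃ c ∈ S, ∃ p ∈ S, ∃ q ∈ S, (¬ G.Adj a b ∧ ¬ G.Adj b c ∧ G.Adj a c) ∧
      (p ≠ q ∧ ¬ G.Adj p q) ∧ ∀ x ∈ ({a, b, c} : Set V), G.Adj x p ∧ G.Adj x q := by
  induction S using WellFoundedLT.induction with | _ S ih
  obtain ⟨a, ha, b, hb, c, hc, d, hd, h4⟩ := h4
  obtain ⟨P, Q, hP, hQ, hdis, rfl, hPQ⟩ := hG S ⟨a, ha, b, hb, h4.1.ne⟩
  have hs : ∀ x y, G.Adj x y → G.Adj y x := fun x y h => h.symm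
  -- A co-`P₃` is connected in the complement, so a join cannot split it; swapping the sides puts it
  -- in `P`.
  wlog hwlog : (∃ a ∈ P, ∃ b ∈ P, ∃ c ∈ P, ¬ G.Adj a b ∧ ¬ G.Adj b c ∧ G.Adj a c) ∨
      (∀ p ∈ P, ∀ q ∈ Q, ¬ G.Adj p q) generalizing P Q
  · rw [Set.union_comm]
    refine this Q P hQ hP hdis.symm ?_ ?_ ?_ ?_ ?_ ?_ ?_ ?_
    all_goals try rwa [Set.union_comm]
    · exact hPQ.imp (fun h p hp q hq => (h q hq p hp).symm) (fun h p hp q hq h' => h q hq p hp h'.symm)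
    · obtain ⟨x, hx, y, hy, z, hz, h1, h2, h3⟩ := h3
      have hPQ := hPQ.resolve_right fun h => hwlog (.inr h)
      rcases hy with hy | hy
      · have hx : x ∈ P := hx.resolve_right fun h => h1 (hPQ y hy x h).symm
        have hz : z ∈ P := hz.resolve_right fun h => h2 (hPQ y hy z h)
        exact (hwlog (.inl ⟨x, hx, y, hy, z, hz, h1, h2, h3⟩)).elim
      · have hx : x ∈ Q := hx.resolve_left fun h => h1 (hPQ x h y hy)
        have hz : z ∈ Q := hz.resolve_left fun h => h2 (hPQ z h y hy).symm
        exact .inl ⟨x, hx, y, hy, z, hz, h1, h2, h3⟩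
  have hd' := Set.disjoint_left.1 hdis
  rcases hPQ with h | h
  · rcases hwlog with hw | hw
    · by_cases hQc : ∀ x ∈ Q, ∀ y ∈ Q, x ≠ y → G.Adj x y
      · have h4P : ∃ a ∈ P, ∃ b ∈ P, ∃ c ∈ P, ∃ d ∈ P, IsC4 G a b c d := by
          obtain ⟨-, -, -, -, hac, hbd, hac', hbd'⟩ := id h4
          -- Each vertex of the `C₄` has a nonneighbour in it, so none lies in the clique `Q`, which
          -- is joined to `P`.
          have key : ∀ x y, x ∈ P ∪ Q → y ∈ P ∪ Q → ¬ G.Adj x y → x ≠ y → x ∈ P := by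
            rintro x y (hx | hx) (hy | hy) hxy hne
            · exact hx
            · exact hx
            · exact (hxy (h y hy x hx).symm).elim
            · exact (hxy (hQc x hx y hy hne)).elim
          exact ⟨a, key a c ha hc hac hac', b, key b d hb hd hbd hbd',
            c, key c a hc ha (fun h => hac h.symm) hac'.symm,
            d, key d b hd hb (fun h => hbd h.symm) hbd'.symm, h4⟩
        obtain ⟨q, hq⟩ := hQ
        have hPs : P ⊂ P ∪ Q := ⟨Set.subset_union_left, fun hs => hd' (hs (.inr hq)) hq⟩
        rcases ih P hPs h4P hw with h | h
        · obtain ⟨a, ha, b, hb, c, hc, d, hd, w, hw, h⟩ := h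
          exact .inl ⟨a, .inl ha, b, .inl hb, c, .inl hc, d, .inl hd, w, .inl hw, h⟩
        · obtain ⟨a, ha, b, hb, c, hc, d, hd, w, hw, h⟩ := h
          exact .inr ⟨a, .inl ha, b, .inl hb, c, .inl hc, d, .inl hd, w, .inl hw, h⟩
      · push Not at hQc
        obtain ⟨p, hp, q, hq, hpq⟩ := hQc
        obtain ⟨x, hx, y, hy, z, hz, h'⟩ := hw
        refine Or.inr ⟨x, .inl hx, y, .inl hy, z, .inl hz, p, .inr hp, q, .inr hq, h', hpq, ?_⟩
        grind
    · obtain ⟨p, hp⟩ := hP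
      obtain ⟨q, hq⟩ := hQ
      exact (hw p hp q hq (h p hp q hq)).elim
  · left
    by_cases haP : a ∈ P
    · obtain ⟨w, hw⟩ := hQ
      refine ⟨a, ha, b, hb, c, hc, d, hd, w, .inr hw, h4, ?_⟩
      unfold IsC4 at h4
      have : b ∈ P := by grind
      have : c ∈ P := by grind
      have : d ∈ P := by grind
      grind
    · obtain ⟨w, hw⟩ := hP
      refine ⟨a, ha, b, hb, c, hc, d, hd, w, .inl hw, h4, ?_⟩
      unfold IsC4 at h4
      have : a ∈ Q := by grind
      have : b ∈ Q := by grind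
      have : c ∈ Q := by grind
      have : d ∈ Q := by grind
      grind

end

/-! ### Disconnected graphs that contain an induced `P₃` -/

section
variable {V : Type*} {G : SimpleGraph V}

theorem Near.far (hG : Decomposable G) {y a b : V} (ha : Near G y a) (hb : ¬ Near G y b) :
    a ≠ b ∧ ¬ G.Adj a b :=
  ⟨fun h => hb (h ▸ ha), fun h => hb (ha.step hG h)⟩

theorem IsTwoK2.embedsIn {a b c d : V} (h : IsTwoK2 G a b c d) :
    EmbedsIn (copies 2 (K 2)) G {a, b, c, d} := by
  obtain ⟨hab, hcd, hac, had, hbc, hbd⟩ := h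
  have := (embedsIn_K2 hab).copies_two (embedsIn_K2 hcd) (by
    have := hab.symm
    rintro x (rfl | rfl) y (rfl | rfl) <;> refine ⟨?_, ‹_›⟩ <;> rintro rfl <;> contradiction)
  convert this using 1
  grind

theorem IsTwoK2.embedsIn_butterfly (hG : Decomposable G) {a b c d : V} (h : IsTwoK2 G a b c d)
    (hn : Near G a c) : ∃ u, G.Adj u a ∧
      EmbedsIn (join (K 1) (copies 2 (K 2))) G ({u} ∪ {a, b, c, d}) := by
  obtain ⟨u, ha, hb, hc, hd⟩ := h.exists_dominating hG hn
  refine ⟨u, ha, (embedsIn_K1 u).join h.embedsIn ?_⟩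
  simp [*]

theorem IsC4.embedsIn {a b c d : V} (h : IsC4 G a b c d) : EmbedsIn C4 G {a, b, c, d} := by
  obtain ⟨h1, h2, h3, h4, h5, h6, h7, h8⟩ := h
  exact embedsIn_C4 h1 h2 h3 h4 h5 h6 h7 h8

theorem embedsIn_copies_two_K1 {a b : V} (h : ¬ G.Adj a b) (hne : a ≠ b) :
    EmbedsIn (copies 2 (K 1)) G ({a} ∪ {b}) :=
  (embedsIn_K1 a).copies_two (embedsIn_K1 b) (by simp [h, hne])

/-- A triple inducing the complement of `P₃`, inside the complement graph. -/
theorem embedsIn_compl_P3 {a b c : V} (hab : ¬ G.Adj a b) (hbc : ¬ G.Adj b c) (hac : G.Adj a c) :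
    EmbedsIn P3 Gᶜ {a, b, c} := by
  refine embedsIn_P3 ?_ ?_ (by simp [hac]) hac.ne
  · rw [SimpleGraph.compl_adj]; exact ⟨by rintro rfl; exact hbc hac, hab⟩
  · rw [SimpleGraph.compl_adj]; exact ⟨by rintro rfl; exact hab hac, hbc⟩

/-- The cases concern the vertices outside the component of `y`. A `P₃` there gives `2P₃`. Otherwise
they form a cluster: several cliques with an edge, several isolated vertices, one clique of size at
least two, or the single vertex `w`. -/
theorem exists_obstruction_of_P3 [Finite V] (hG : Decomposable G) {x y z w : V}
    (hxy : G.Adj x y) (hyz : G.Adj y z) (hxz : ¬ G.Adj x z) (hxz' : x ≠ z) (hw : ¬ Near G y w)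
    (hnp : ∀ A : Set V, MultipartiteOn G A → ∃ a ∉ A, ∃ b ∉ A, a ≠ b ∧ ¬ G.Adj a b) :
    (∃ S, EmbedsIn (C4 ⊕g copies 2 (K 1)) G S) ∨ (∃ S, EmbedsIn (copies 2 P3) G S) ∨
    (∃ S, EmbedsIn (K 1 ⊕g (P3 ⊕g K 2)ᶜ) G S) ∨ (∃ S, EmbedsIn (K 2 ⊕g (P3 ⊕g K 1)ᶜ) G S) ∨
    (∃ S, EmbedsIn (K 1 ⊕g K 2 ⊕g P3) G S) ∨
    (∃ S, EmbedsIn (K 1 ⊕g join (K 1) (copies 2 (K 2))) G S) := by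
  have hsym : ∀ a b, G.Adj a b → G.Adj b a := fun a b h => h.symm
  have hnx : Near G y x := .inr (.inl hxy.symm)
  have hnz : Near G y z := .inr (.inl hyz)
  have hny : Near G y y := .inl rfl
  have hfar : ∀ a b, Near G y a → ¬ Near G y b → a ≠ b ∧ ¬ G.Adj a b := fun a b => Near.far hG
  have hfar' : ∀ a b, ¬ Near G y a → Near G y b → a ≠ b ∧ ¬ G.Adj a b := fun a b ha hb =>
    ⟨(hfar b a hb ha).1.symm, fun h => (hfar b a hb ha).2 h.symm⟩
  have hpath := embedsIn_P3 hxy hyz hxz hxz'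
  have hout : ∀ {a b}, ¬ Near G y a → G.Adj a b → ¬ Near G y b := fun ha hab hb =>
    (hfar' _ _ ha hb).2 hab
  have hin : ∀ {a b}, Near G y a → G.Adj a b → Near G y b := fun ha hab => ha.step hG hab
  -- An independent set is complete multipartite, so `hnp` rules out a split graph.
  have hsplit : (∃ a b c d, IsC4 G a b c d) ∨ ∃ a b c d, IsTwoK2 G a b c d := by
    rcases hG.splitOn Set.univ with ⟨A, -, hA, hA'⟩ | h | h
    · obtain ⟨a, ha, b, hb, hab, hab'⟩ := hnp A fun a ha b hb c hc _ _ => hA a ha c hc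
      exact (hab' (hA' a trivial b trivial ha hb hab)).elim
    · simp only [Set.mem_univ, true_and] at h; exact .inl h
    · simp only [Set.mem_univ, true_and] at h; exact .inr h
  by_cases h1 : ∃ a b c, ¬ Near G y a ∧ G.Adj a b ∧ G.Adj b c ∧ ¬ G.Adj a c ∧ a ≠ c
  · obtain ⟨a, b, c, ha, hab, hbc, hac, hac'⟩ := h1
    have hb := hout ha hab
    have hc := hout hb hbc
    refine .inr (.inl ⟨_, hpath.copies_two (embedsIn_P3 hab hbc hac hac') ?_⟩)
    rintro p (rfl | rfl | rfl) q (rfl | rfl | rfl) <;> apply hfar <;> assumption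
  have hcl : ∀ a b c, ¬ Near G y a → G.Adj a b → G.Adj b c → a ≠ c → G.Adj a c := by
    intro a b c ha hab hbc hac
    by_contra hac'
    exact h1 ⟨a, b, c, ha, hab, hbc, hac', hac⟩
  by_cases h2 : ∃ a b, ¬ Near G y a ∧ ¬ Near G y b ∧ a ≠ b ∧ ¬ G.Adj a b
  · obtain ⟨p, q, hp, hq, hpq, hpq'⟩ := h2
    by_cases h3 : ∃ a b, ¬ Near G y a ∧ G.Adj a b
    · obtain ⟨a, b, ha, hab⟩ := h3
      have hb := hout ha hab
      -- Otherwise every outer vertex, in particular `p` and `q`, would lie in the clique of `a`.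
      have : ∃ r, ¬ Near G y r ∧ r ≠ a ∧ r ≠ b ∧ ¬ G.Adj r a ∧ ¬ G.Adj r b := by
        by_contra hcon
        have key : ∀ r, ¬ Near G y r → r = a ∨ G.Adj r a := by
          intro r hr
          by_contra hra
          push Not at hra
          refine hcon ⟨r, hr, hra.1, ?_, hra.2, ?_⟩
          · rintro rfl; exact hra.2 hab.symm
          · intro h; exact hra.2 (hcl r b a hr h hab.symm hra.1)
        rcases key p hp with rfl | h4 <;> rcases key q hq with rfl | h5
        · exact hpq rfl
        · exact hpq' h5.symm
        · exact hpq' h4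
        · exact hpq' (hcl p a q hp h4 h5.symm hpq)
      obtain ⟨r, hr, hra, hrb, hra', hrb'⟩ := this
      refine .inr (.inr (.inr (.inr (.inl ⟨_, ((embedsIn_K1 r).sum (embedsIn_K2 hab) ?_).sum
        hpath ?_⟩))))
      · simp [*]
      · rintro s (rfl | rfl | rfl) t (rfl | rfl | rfl) <;> apply hfar' <;> assumption
    · push Not at h3
      rcases hsplit with ⟨a, b, c, d, h⟩ | ⟨a, b, c, d, h⟩
      · obtain ⟨hab, hbc, hcd, -⟩ := id h
        have ha : Near G y a := by_contra fun ha => h3 a b ha hab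
        have hb := hin ha hab
        have hc := hin hb hbc
        have hd := hin hc hcd
        refine .inl ⟨_, h.embedsIn.sum (embedsIn_copies_two_K1 hpq' hpq) ?_⟩
        rintro s (rfl | rfl | rfl | rfl) t (rfl | rfl) <;> apply hfar <;> assumption
      · obtain ⟨hab, hcd, -⟩ := id h
        have ha : Near G y a := by_contra fun ha => h3 a b ha hab
        have hc : Near G y c := by_contra fun hc => h3 c d hc hcd
        have hb := hin ha hab
        have hd := hin hc hcd
        obtain ⟨u, hu, hb⟩ := h.embedsIn_butterfly hG (ha.symm.trans hG hc)
        have hu := hin ha hu.symm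
        refine .inr (.inr (.inr (.inr (.inr ⟨_, (embedsIn_K1 p).sum hb ?_⟩))))
        rintro s rfl t (rfl | rfl | rfl | rfl | rfl) <;> apply hfar' <;> assumption
  · push Not at h2
    -- The outside is now a clique, so by `hnp` the component of `y` cannot be complete
    -- multipartite.
    have hco : ∃ a b c, Near G y a ∧ Near G y b ∧ Near G y c ∧
        ¬ G.Adj a b ∧ ¬ G.Adj b c ∧ G.Adj a c := by
      by_contra hcon
      push Not at hcon
      obtain ⟨a, ha, b, hb, hab, hab'⟩ := hnp {v | Near G y v}
        fun a ha b hb c hc h h' => hcon a b c ha hb hc h h'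
      exact hab' (h2 a b ha hb hab)
    obtain ⟨a, b, c, ha, hb, hc, hab, hbc, hac⟩ := hco
    obtain ⟨u, hua, hub, huc⟩ := hG.exists_paw hab hbc hac (hb.symm.trans hG ha)
    have hu := hin ha hua.symm
    by_cases h4 : ∃ w', ¬ Near G y w' ∧ w' ≠ w
    · obtain ⟨w', hw', hne⟩ := h4
      refine .inr (.inr (.inr (.inl ⟨_, (embedsIn_K2 (h2 w' w hw' hw hne)).sum
        (((embedsIn_compl_P3 hab hbc hac).sum (embedsIn_K1 u) ?_).compl) ?_⟩)))
      · rintro s (rfl | rfl | rfl) t rfl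
        · exact ⟨hua.ne.symm, by simp [hua.symm]⟩
        · exact ⟨hub.ne.symm, by simp [hub.symm]⟩
        · exact ⟨huc.ne.symm, by simp [huc.symm]⟩
      · rintro s (rfl | rfl) t ((rfl | rfl | rfl) | rfl) <;> apply hfar' <;> assumption
    push Not at h4
    -- With `w` the only outer vertex, every edge lies in the component of `y`.
    have hnear : ∀ {a b}, G.Adj a b → Near G y a := fun {a b} hab => by_contra fun ha =>
      hab.ne ((h4 a ha).trans (h4 b (hout ha hab)).symm)
    rcases hsplit with ⟨p, q, r, s, h⟩ | ⟨p, q, r, s, h⟩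
    · obtain ⟨hpq, hqr, hrs, -⟩ := id h
      rcases hG.C4_and_coP3 {v | Near G y v} ⟨p, hnear hpq, q, hnear hqr, r, hnear hrs, s,
          hnear hrs.symm, h⟩ ⟨a, ha, b, hb, c, hc, hab, hbc, hac⟩ with
        ⟨p, hp, q, hq, r, hr, s, hs, t, ht, h, h'⟩ |
        ⟨a, ha, b, hb, c, hc, p, hp, q, hq, ⟨hab, hbc, hac⟩, hpq, h⟩
      · have htw := hfar t w ht hw
        refine .inl ⟨_, h.embedsIn.sum (embedsIn_copies_two_K1 htw.2 htw.1) ?_⟩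
        rintro m hm n (rfl | rfl)
        · exact h' m hm
        · refine hfar m n ?_ hw
          rcases hm with rfl | rfl | rfl | rfl <;> assumption
      · refine .inr (.inr (.inl ⟨_, (embedsIn_K1 w).sum (((embedsIn_compl_P3 hab hbc hac).sum
          (embedsIn_K2 (by rwa [SimpleGraph.compl_adj])) ?_).compl) ?_⟩))
        · rintro s hs t (rfl | rfl)
          · exact ⟨(h s hs).1.ne, by simp [(h s hs).1]⟩
          · exact ⟨(h s hs).2.ne, by simp [(h s hs).2]⟩
        · rintro s rfl t ((rfl | rfl | rfl) | (rfl | rfl)) <;> apply hfar' <;> assumption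
    · obtain ⟨hpq, hrs, -⟩ := id h
      have hp := hnear hpq
      have hr := hnear hrs
      have hq := hin hp hpq
      have hs := hin hr hrs
      obtain ⟨u, hu, hb⟩ := h.embedsIn_butterfly hG (hp.symm.trans hG hr)
      have hu := hin hp hu.symm
      refine .inr (.inr (.inr (.inr (.inr ⟨_, (embedsIn_K1 w).sum hb ?_⟩))))
      rintro s rfl t (rfl | rfl | rfl | rfl | rfl) <;> apply hfar' <;> assumption

end

/-! ### The cluster case and the descent through joins -/

section
variable {V : Type*} {G : SimpleGraph V}

/-- The equivalence relation whose classes are the cliques of a `P₃`-free graph. -/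
def clusterSetoid (G : SimpleGraph V)
    (hcl : ∀ a b c, G.Adj a b → G.Adj b c → a ≠ c → G.Adj a c) : Setoid V where
  r a b := a = b ∨ G.Adj a b
  iseqv := ⟨fun _ => .inl rfl, fun h => h.imp Eq.symm SimpleGraph.Adj.symm, by
    rintro a b c (rfl | h) (rfl | h')
    · exact .inl rfl
    · exact .inr h'
    · exact .inr h
    · by_cases hac : a = c
      · exact .inl hac
      · exact .inr (hcl a b c h h' hac)⟩

theorem exists_obstruction_of_cluster [Finite V] (hG : Decomposable G) (k : ℕ)
    (hcl : ∀ a b c, G.Adj a b → G.Adj b c → a ≠ c → G.Adj a c)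
    (hnp : ∀ A : Set V, MultipartiteOn G A → ∃ a ∉ A, ∃ b ∉ A, a ≠ b ∧ ¬ G.Adj a b) :
    (∃ S, EmbedsIn (copies (k - 1) (K 1) ⊕g copies 2 (K 2)) G S) ∨
      (∃ f : V → Fin k, ClusterOn G f Set.univ) ∧
        ∃ S, EmbedsIn (K 1 ⊕g copies 2 (K 2)) G S := by
  obtain ⟨a, b, c, d, h⟩ : ∃ a b c d, IsTwoK2 G a b c d := by
    rcases hG.splitOn Set.univ with ⟨A, -, hA, hA'⟩ | h | h
    · obtain ⟨a, ha, b, hb, hab, hab'⟩ := hnp A fun a ha b hb c hc _ _ => hA a ha c hc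
      exact (hab' (hA' a trivial b trivial ha hb hab)).elim
    · obtain ⟨a, -, b, -, c, -, d, -, h1, h2, -, -, h3, -, h4, -⟩ := h
      exact (h3 (hcl a b c h1 h2 h4)).elim
    · simp only [Set.mem_univ, true_and] at h; exact h
  obtain ⟨hab, hcd, hac, had, hbc, hbd⟩ := id h
  have hca : c ≠ a := by rintro rfl; exact had hcd
  let s := clusterSetoid G hcl
  have hs : ∀ x y : V, (⟦x⟧ : Quotient s) = ⟦y⟧ ↔ x = y ∨ G.Adj x y := fun x y => Quotient.eq
  have hout : ∀ w : V, (⟦w⟧ : Quotient s) ≠ ⟦a⟧ → (⟦w⟧ : Quotient s) ≠ ⟦c⟧ →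
      ∀ y ∈ ({a, b, c, d} : Set V), w ≠ y ∧ ¬ G.Adj w y := by
    intro w ha hc y hy
    have hb' : (⟦b⟧ : Quotient s) = ⟦a⟧ := (hs _ _).2 (.inr hab.symm)
    have hd' : (⟦d⟧ : Quotient s) = ⟦c⟧ := (hs _ _).2 (.inr hcd.symm)
    have : (⟦w⟧ : Quotient s) ≠ ⟦y⟧ := by
      rcases hy with rfl | rfl | rfl | rfl
      · exact ha
      · rwa [hb']
      · exact hc
      · rwa [hd']
    rwa [Ne, hs, not_or] at this
  by_cases hk : Nat.card (Quotient s) ≤ k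
  · right
    refine ⟨⟨fun v => Fin.castLE hk (Finite.equivFin (Quotient s) ⟦v⟧), ?_⟩, ?_⟩
    · intro x _ y _
      simp only [Fin.castLE_inj, EmbeddingLike.apply_eq_iff_eq, hs]
      have := G.ne_of_adj (a := x) (b := y)
      tauto
    -- The clique of `a` is itself complete multipartite. Its removal leaves two nonadjacent
    -- vertices, and at least one of them is outside the clique of `c`.
    · obtain ⟨x, hx, y, hy, hxy, hxy'⟩ := hnp {v | (⟦v⟧ : Quotient s) = ⟦a⟧} (by
        intro x hx y hy z hz h1 h2
        have hxy := ((hs x y).1 (hx.trans hy.symm)).resolve_right h1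
        have hyz := ((hs y z).1 (hy.trans hz.symm)).resolve_right h2
        simp [hxy, hyz])
      have : ∃ w, (⟦w⟧ : Quotient s) ≠ ⟦a⟧ ∧ (⟦w⟧ : Quotient s) ≠ ⟦c⟧ := by
        by_cases hxc : (⟦x⟧ : Quotient s) = ⟦c⟧
        · refine ⟨y, hy, fun hyc => ?_⟩
          have := (hs x y).1 (hxc.trans hyc.symm)
          tauto
        · exact ⟨x, hx, hxc⟩
      obtain ⟨w, hwa, hwc⟩ := this
      refine ⟨_, (embedsIn_K1 w).sum h.embedsIn ?_⟩
      rintro _ rfl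
      exact hout _ hwa hwc
  · left
    -- Of at least `k + 1` cliques, two hold the `2K₂`; each of the other `k - 1` or more supplies
    -- an isolated vertex.
    have hcard : Nat.card (Fin (k - 1)) ≤
        Nat.card {q : Quotient s // q ∉ ({⟦a⟧, ⟦c⟧} : Set (Quotient s))} := by
      have h1 := Set.ncard_add_ncard_compl ({⟦a⟧, ⟦c⟧} : Set (Quotient s))
      have h2 := Set.ncard_insert_le (⟦a⟧ : Quotient s) {⟦c⟧}
      rw [Set.ncard_singleton] at h2
      change _ ≤ Nat.card ({⟦a⟧, ⟦c⟧}ᶜ : Set (Quotient s))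
      rw [Nat.card_coe_set_eq, Nat.card_fin]
      omega
    rw [Nat.card_fin] at hcard
    let e : Fin (k - 1) ↪ {q : Quotient s // q ∉ ({⟦a⟧, ⟦c⟧} : Set (Quotient s))} :=
      (Fin.castLEEmb hcard).trans (Finite.equivFin _).symm.toEmbedding
    have hmk : ∀ q : Quotient s, (⟦q.out⟧ : Quotient s) = q := Quotient.out_eq
    refine ⟨_, (embedsIn_copies_K1 (ι := fun i => (e i).1.out) ?_ ?_).sum h.embedsIn ?_⟩
    · intro i j hij
      apply e.injective
      apply Subtype.ext
      rw [← hmk (e i).1, ← hmk (e j).1, show (e i).1.out = (e j).1.out from hij]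
    · intro i j hij
      have := (hs _ _).2 (.inr hij)
      rw [hmk, hmk] at this
      have := e.injective (Subtype.ext this)
      subst this
      exact hij.ne rfl
    · rintro _ ⟨i, rfl⟩
      have := (e i).2
      simp only [Set.mem_insert_iff, Set.mem_singleton_iff, not_or] at this
      apply hout
      · rw [hmk]; exact this.1
      · rw [hmk]; exact this.2

/-- `S` is the disjoint union of a set inducing a complete multipartite graph and a clique. -/
def InfOneOn (G : SimpleGraph V) (S : Set V) : Prop :=
  ∃ A ⊆ S, MultipartiteOn G A ∧ ∀ a ∈ S, ∀ b ∈ S, a ∉ A → b ∉ A → a ≠ b → G.Adj a b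

/-- Joins preserve both complete multipartite graphs and cliques. -/
theorem InfOneOn.union {P Q : Set V} (hP : InfOneOn G P) (hQ : InfOneOn G Q)
    (h : ∀ p ∈ P, ∀ q ∈ Q, G.Adj p q) : InfOneOn G (P ∪ Q) := by
  obtain ⟨A, hAP, hA, hA'⟩ := hP
  obtain ⟨B, hBQ, hB, hB'⟩ := hQ
  have hs : ∀ x y, G.Adj x y → G.Adj y x := fun x y h => h.symm
  refine ⟨A ∪ B, Set.union_subset_union hAP hBQ, ?_, by grind⟩
  rintro a (ha | ha) b (hb | hb) c (hc | hc) hab hbc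
  · exact hA a ha b hb c hc hab hbc
  · exact (hbc (h b (hAP hb) c (hBQ hc))).elim
  · exact (hab (h a (hAP ha) b (hBQ hb))).elim
  · exact (hab (h a (hAP ha) b (hBQ hb))).elim
  · exact (hab (h b (hAP hb) a (hBQ ha)).symm).elim
  · exact (hab (h b (hAP hb) a (hBQ ha)).symm).elim
  · exact (hbc (h c (hAP hc) b (hBQ hb)).symm).elim
  · exact hB a ha b hb c hc hab hbc

/-- If `G` is connected and not `(∞, 1)`-polar, some disconnected `X`, completely joined to its
nonempty complement, is not `(∞, 1)`-polar. -/
theorem exists_disconnected_not_infOneOn [Finite V] (hG : Decomposable G)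
    (hconn : ∀ P Q : Set V, P.Nonempty → Q.Nonempty → Disjoint P Q → P ∪ Q = Set.univ →
      ¬ ∀ p ∈ P, ∀ q ∈ Q, ¬ G.Adj p q)
    (hnp : ¬ InfOneOn G Set.univ) :
    ∃ X : Set V, (∃ y, y ∉ X) ∧ (∀ x ∈ X, ∀ y ∉ X, G.Adj x y) ∧ ¬ InfOneOn G X ∧
      ∃ P Q : Set V, P.Nonempty ∧ Q.Nonempty ∧ Disjoint P Q ∧ P ∪ Q = X ∧
        ∀ p ∈ P, ∀ q ∈ Q, ¬ G.Adj p q := by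
  have hnt : ∀ X : Set V, ¬ InfOneOn G X → X.Nontrivial := by
    intro X hX
    by_contra h
    rw [Set.not_nontrivial_iff] at h
    refine hX ⟨X, subset_rfl, fun a ha b hb c hc hab _ => ?_, fun a ha _ _ h => (h ha).elim⟩
    rwa [← h hb hc]
  have hsplit : ∀ {P Q : Set V}, (∀ p ∈ P, ∀ q ∈ Q, G.Adj p q) → ¬ InfOneOn G (P ∪ Q) →
      ¬ InfOneOn G P ∨ ¬ InfOneOn G Q := by
    intro P Q h h'
    by_contra hcon
    push Not at hcon
    exact h' (hcon.1.union hcon.2 h)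
  let F : Set (Set V) := {X | (∃ y, y ∉ X) ∧ (∀ x ∈ X, ∀ y ∉ X, G.Adj x y) ∧ ¬ InfOneOn G X}
  have hF : F.Nonempty := by
    obtain ⟨P, Q, hP, hQ, hd, hu, h⟩ := hG Set.univ (hnt _ hnp)
    have hd' := Set.disjoint_left.1 hd
    have h := h.resolve_right (hconn P Q hP hQ hd hu)
    have hcov : ∀ v, v ∈ P ∨ v ∈ Q := fun v => by
      have : v ∈ P ∪ Q := hu ▸ trivial
      exact this
    rcases hsplit h (hu ▸ hnp) with h' | h'
    · exact ⟨P, ⟨hQ.choose, fun h => hd' h hQ.choose_spec⟩,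
        fun x hx y hy => h x hx y ((hcov y).resolve_left hy), h'⟩
    · exact ⟨Q, ⟨hP.choose, fun h => hd' hP.choose_spec h⟩,
        fun x hx y hy => (h y ((hcov y).resolve_right hy) x hx).symm, h'⟩
  -- If a minimal `X` were itself a join, one factor would fail to be `(∞, 1)`-polar and would be a
  -- smaller member of `F`.
  obtain ⟨X, hXF, hmin⟩ := wellFounded_lt.has_min F hF
  obtain ⟨⟨y, hy⟩, hX, hX'⟩ := id hXF
  refine ⟨X, ⟨y, hy⟩, hX, hX', ?_⟩
  obtain ⟨P, Q, hP, hQ, hd, rfl, h⟩ := hG X (hnt _ hX')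
  have hd' := Set.disjoint_left.1 hd
  refine ⟨P, Q, hP, hQ, hd, rfl, h.resolve_left fun h => ?_⟩
  rcases hsplit h hX' with h' | h'
  · refine hmin P ⟨⟨y, fun h => hy (.inl h)⟩, fun x hx z hz => ?_, h'⟩
      ⟨Set.subset_union_left, fun hs => hd' (hs (.inr hQ.choose_spec)) hQ.choose_spec⟩
    by_cases hzQ : z ∈ Q
    · exact h x hx z hzQ
    · exact hX x (.inl hx) z (fun h => h.elim hz hzQ)
  · refine hmin Q ⟨⟨y, fun h => hy (.inr h)⟩, fun x hx z hz => ?_, h'⟩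
      ⟨Set.subset_union_right, fun hs => hd' hP.choose_spec (hs (.inl hP.choose_spec))⟩
    by_cases hzP : z ∈ P
    · exact (h z hzP x hx).symm
    · exact hX x (.inr hx) z (fun h => h.elim hzP hz)

theorem exists_obstruction [Finite V] (hG : Decomposable G) {k : ℕ} (hk : 0 < k)
    (hconn : ∀ P Q : Set V, P.Nonempty → Q.Nonempty → Disjoint P Q → P ∪ Q = Set.univ →
      ¬ ∀ p ∈ P, ∀ q ∈ Q, ¬ G.Adj p q)
    (hnp : ¬ InfOneOn G Set.univ)
    (hnp' : ∀ (A : Set V) (f : V → Fin k), (∀ a ∈ A, ∀ b ∈ A, ¬ G.Adj a b) →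
      ¬ ClusterOn G f Aᶜ) :
    (∃ S, EmbedsIn (join (K 1) (C4 ⊕g copies 2 (K 1))) G S) ∨
    (∃ S, EmbedsIn (join (K 1) (copies 2 P3)) G S) ∨
    (∃ S, EmbedsIn (join (K 1) (K 1 ⊕g (P3 ⊕g K 2)ᶜ)) G S) ∨
    (∃ S, EmbedsIn (join (K 1) (K 2 ⊕g (P3 ⊕g K 1)ᶜ)) G S) ∨
    (∃ S, EmbedsIn (join (K 2) (K 1 ⊕g copies 2 (K 2))) G S) ∨
    (∃ S, EmbedsIn (join (K 1) (K 1 ⊕g K 2 ⊕g P3)) G S) ∨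
    (∃ S, EmbedsIn (join (K 1) (K 1 ⊕g join (K 1) (copies 2 (K 2)))) G S) ∨
    (∃ S, EmbedsIn (join (K 1) (copies (k - 1) (K 1) ⊕g copies 2 (K 2))) G S) := by
  classical
  obtain ⟨X, ⟨y, hy⟩, hX, hX', P, Q, hP, hQ, hd, hPQ, hanti⟩ :=
    exists_disconnected_not_infOneOn hG hconn hnp
  have hD : Decomposable (G.induce X) := hG.comap (SimpleGraph.Embedding.induce X)
  have hnX : ∀ A : Set X, MultipartiteOn (G.induce X) A →
      ∃ a ∉ A, ∃ b ∉ A, a ≠ b ∧ ¬ (G.induce X).Adj a b := by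
    intro A hA
    by_contra hcon
    push Not at hcon
    refine hX' ⟨Subtype.val '' A, by simp, ?_, ?_⟩
    · rintro _ ⟨a, ha, rfl⟩ _ ⟨b, hb, rfl⟩ _ ⟨c, hc, rfl⟩
      exact hA a ha b hb c hc
    · intro a ha b hb ha' hb' hab
      exact hcon ⟨a, ha⟩ (fun h => ha' ⟨_, h, rfl⟩) ⟨b, hb⟩ (fun h => hb' ⟨_, h, rfl⟩)
        (fun h => hab (congrArg Subtype.val h))
  have hval : ∀ {W : Type} {L : SimpleGraph W}, (∃ S, EmbedsIn L (G.induce X) S) →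
      EmbedsIn L G X := by
    rintro W L ⟨S, f, hfi, hfa, -⟩
    exact ⟨fun x => f x, Subtype.val_injective.comp hfi, hfa, fun x => (f x).2⟩
  have hub : ∀ {W : Type} {L : SimpleGraph W}, (∃ S, EmbedsIn L (G.induce X) S) →
      ∃ S, EmbedsIn (join (K 1) L) G S := by
    intro W L h
    refine ⟨_, (embedsIn_K1 y).join (hval h) ?_⟩
    rintro _ rfl b hb
    exact (hX b hb _ hy).symm
  by_cases h3 : ∃ a b c : X, (G.induce X).Adj a b ∧ (G.induce X).Adj b c ∧
      ¬ (G.induce X).Adj a c ∧ a ≠ c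
  · obtain ⟨a, b, c, hab, hbc, hac, hne⟩ := h3
    have hw : ∃ w, ¬ Near (G.induce X) b w := by
      have hPX : P ⊆ X := hPQ ▸ Set.subset_union_left
      have hQX : Q ⊆ X := hPQ ▸ Set.subset_union_right
      have hcov : ∀ v : X, v.1 ∈ P ∨ v.1 ∈ Q := fun v => by
        have : v.1 ∈ P ∪ Q := hPQ ▸ v.2
        exact this
      have hcl : ∀ u v : X, G.Adj u v → (u.1 ∈ P ↔ v.1 ∈ P) ∧ (u.1 ∈ Q ↔ v.1 ∈ Q) := by
        intro u v huv
        have h1 := fun h h' => hanti u h v h' huv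
        have h2 := fun h h' => hanti v h u h' huv.symm
        have := hcov u
        have := hcov v
        tauto
      have hn : ∀ u v : X, Near (G.induce X) u v →
          (u.1 ∈ P ↔ v.1 ∈ P) ∧ (u.1 ∈ Q ↔ v.1 ∈ Q) := by
        rintro u v (rfl | h | ⟨w, h, h'⟩)
        · simp
        · exact hcl u v h
        · exact ⟨(hcl u w h).1.trans (hcl w v h').1, (hcl u w h).2.trans (hcl w v h').2⟩
      have hd' := Set.disjoint_left.1 hd
      obtain ⟨p, hp⟩ := hP
      obtain ⟨q, hq⟩ := hQ
      rcases hcov b with hb | hb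
      · exact ⟨⟨q, hQX hq⟩, fun h => hd' ((hn _ _ h).1.1 hb) hq⟩
      · exact ⟨⟨p, hPX hp⟩, fun h => hd' hp ((hn _ _ h).2.1 hb)⟩
    obtain ⟨w, hw⟩ := hw
    rcases exists_obstruction_of_P3 hD hab hbc hac hne hw hnX with h | h | h | h | h | h
    · exact .inl (hub h)
    · exact .inr (.inl (hub h))
    · exact .inr (.inr (.inl (hub h)))
    · exact .inr (.inr (.inr (.inl (hub h))))
    · exact .inr (.inr (.inr (.inr (.inr (.inl (hub h))))))
    · exact .inr (.inr (.inr (.inr (.inr (.inr (.inl (hub h)))))))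
  · push Not at h3
    have hcl : ∀ a b c : X, (G.induce X).Adj a b → (G.induce X).Adj b c → a ≠ c →
        (G.induce X).Adj a c := by
      intro a b c hab hbc hac
      by_contra h
      exact hac (h3 a b c hab hbc h)
    rcases exists_obstruction_of_cluster hD k hcl hnX with h | ⟨⟨f, hf⟩, h⟩
    · exact .inr (.inr (.inr (.inr (.inr (.inr (.inr (hub h)))))))
    · by_cases hedge : ∃ u ∉ X, ∃ v ∉ X, G.Adj u v
      · obtain ⟨u, hu, v, hv, huv⟩ := hedge
        refine .inr (.inr (.inr (.inr (.inl ⟨_, (embedsIn_K2 huv).join (hval h) ?_⟩))))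
        rintro _ (rfl | rfl) b hb
        · exact (hX b hb _ hu).symm
        · exact (hX b hb _ hv).symm
      -- If the complement of `X` is independent, it and the `k`-cluster `X` form the partition
      -- forbidden by `hnp'`.
      · push Not at hedge
        refine (hnp' Xᶜ (fun v => if h : v ∈ X then f ⟨v, h⟩ else ⟨0, hk⟩) hedge ?_).elim
        intro a ha b hb
        rw [compl_compl] at ha hb
        simpa [ha, hb] using hf ⟨a, ha⟩ trivial ⟨b, hb⟩ trivial

end

/-! ### Critical graphs: certificates for the eight graphs -/

section
variable {W : Type*} {L : SimpleGraph W}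

/-- The conditions on a graph `L` under which `(k - 1)K₁ + L` is a minimal `(∞, k)`-polar
obstruction. -/
structure Critical (k : ℕ) (L : SimpleGraph W) : Prop where
  not_infOne : ¬ InfOneOn L Set.univ
  not_oneCluster : ∀ (A : Set W) (f : W → Fin k), (∀ a ∈ A, ∀ b ∈ A, ¬ L.Adj a b) →
    ¬ ClusterOn L f Aᶜ
  infTwo : ∃ (A : Set W) (f : W → Fin 2), MultipartiteOn L A ∧ ClusterOn L f Aᶜ
  delete : ∀ v, InfOneOn L {v}ᶜ ∨ ∃ (A : Set W) (f : W → Fin k),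
    (∀ a ∈ A \ {v}, ∀ b ∈ A \ {v}, ¬ L.Adj a b) ∧ ClusterOn L f (Aᶜ \ {v})

/-- The adjacency of a seven-vertex graph whose adjacency matrix is written in binary. -/
def bitAdj (n : ℕ) (i j : Fin 7) : Bool := n.testBit (7 * i + j)

/-- No vertex set, given by its indicator, is complete multipartite with a clique as complement. -/
def NotInfOneBits (n : ℕ) : Prop := ∀ b : Fin 7 → Bool,
  (∃ i, b i ∧ ∃ l, b l ∧ bitAdj n i l ∧ ∃ j, b j ∧ !bitAdj n i j ∧ !bitAdj n j l) ∨
    ∃ i, !b i ∧ ∃ j, !b j ∧ i ≠ j ∧ !bitAdj n i j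

/-- No vertex set, given by its indicator, is independent with a cluster as complement. -/
def NotOneClusterBits (n : ℕ) : Prop := ∀ b : Fin 7 → Bool,
  (∃ i, b i ∧ ∃ j, b j ∧ bitAdj n i j) ∨
    ∃ i, !b i ∧ ∃ j, !b j ∧ bitAdj n i j ∧ ∃ l, !b l ∧ i ≠ l ∧ bitAdj n j l ∧ !bitAdj n i l

def MultipartiteBits (n : ℕ) (p : Fin 7 → Bool) : Prop :=
  ∀ i, p i → ∀ j, p j → ∀ l, p l → bitAdj n i l → bitAdj n i j ∨ bitAdj n j l

def CliqueBits (n : ℕ) (p : Fin 7 → Bool) : Prop :=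
  ∀ i, p i → ∀ j, p j → i ≠ j → bitAdj n i j

def IndepBits (n : ℕ) (p : Fin 7 → Bool) : Prop :=
  ∀ i, p i → ∀ j, p j → !bitAdj n i j

def ClusterBits {m : ℕ} (n : ℕ) (c : Fin 7 → Fin m) (p : Fin 7 → Bool) : Prop :=
  ∀ i, p i → ∀ j, p j → (bitAdj n i j ↔ i ≠ j ∧ c i = c j)

/-- Colour `0` marks a complete multipartite set, the other colours the cliques of a cluster. -/
def InfTwoBits (n : ℕ) (c : Fin 7 → Fin 3) : Prop :=
  MultipartiteBits n (fun i => c i = 0) ∧ ClusterBits n c (fun i => c i ≠ 0)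

/-- After deleting `v`, colour `0` marks a complete multipartite set and the other colours a clique,
or colour `0` marks an independent set and the other colours the cliques of a cluster. -/
def DeleteBits (n : ℕ) (v : Fin 7) (c : Fin 7 → Fin 4) : Prop :=
  MultipartiteBits n (fun i => i ≠ v ∧ c i = 0) ∧ CliqueBits n (fun i => i ≠ v ∧ c i ≠ 0) ∨
    IndepBits n (fun i => i ≠ v ∧ c i = 0) ∧ ClusterBits n c (fun i => i ≠ v ∧ c i ≠ 0)

instance (n : ℕ) : Decidable (NotInfOneBits n) := by unfold NotInfOneBits; infer_instance
instance (n : ℕ) : Decidable (NotOneClusterBits n) := by unfold NotOneClusterBits; infer_instance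
instance (n : ℕ) (p : Fin 7 → Bool) : Decidable (MultipartiteBits n p) := by
  unfold MultipartiteBits; infer_instance
instance (n : ℕ) (p : Fin 7 → Bool) : Decidable (CliqueBits n p) := by
  unfold CliqueBits; infer_instance
instance (n : ℕ) (p : Fin 7 → Bool) : Decidable (IndepBits n p) := by
  unfold IndepBits; infer_instance
instance {m : ℕ} (n : ℕ) (c : Fin 7 → Fin m) (p : Fin 7 → Bool) :
    Decidable (ClusterBits n c p) := by
  unfold ClusterBits; infer_instance
instance (n : ℕ) (c : Fin 7 → Fin 3) : Decidable (InfTwoBits n c) := by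
  unfold InfTwoBits; infer_instance
instance (n : ℕ) (v : Fin 7) (c : Fin 7 → Fin 4) : Decidable (DeleteBits n v c) := by
  unfold DeleteBits; infer_instance

instance : DecidableRel P3.Adj := fun _ _ => decidable_of_iff _ SimpleGraph.pathGraph_adj.symm

instance {V W : Type*} (G : SimpleGraph V) (H : SimpleGraph W) [DecidableRel G.Adj]
    [DecidableRel H.Adj] : DecidableRel (join G H).Adj := by
  rintro (a | a) (b | b)
  · exact decidable_of_iff _ (join_adj_inl_inl G H a b).symm
  · exact .isTrue (join_adj_inl_inr G H a b)
  · exact .isTrue (join_adj_inr_inl G H a b)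
  · exact decidable_of_iff _ (join_adj_inr_inr G H a b).symm

instance {V W : Type*} (G : SimpleGraph V) (H : SimpleGraph W) [DecidableRel G.Adj]
    [DecidableRel H.Adj] : DecidableRel (G ⊕g H).Adj := by
  rintro (a | a) (b | b)
  · exact inferInstanceAs (Decidable (G.Adj a b))
  · exact .isFalse (by simp)
  · exact .isFalse (by simp)
  · exact inferInstanceAs (Decidable (H.Adj a b))

instance {V : Type*} [DecidableEq V] (n : ℕ) (G : SimpleGraph V) [DecidableRel G.Adj] :
    DecidableRel (copies n G).Adj := fun x y =>
  inferInstanceAs (Decidable (x.1 = y.1 ∧ G.Adj x.2 y.2))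

/-- The certificates do not depend on `k`: the negative check forbids clusters with any number of
cliques, and the partitions after deletions use at most three cliques, hence `3 ≤ k`. -/
theorem Critical.of_bits {k : ℕ} (hk : 3 ≤ k) (n : ℕ) (g : Fin 7 → W) (c₀ : Fin 7 → Fin 3)
    (c : Fin 7 → Fin 7 → Fin 4) (hgi : Function.Injective g) (hgs : Function.Surjective g)
    (hadj : ∀ i j, L.Adj (g i) (g j) ↔ bitAdj n i j) (h₁ : NotInfOneBits n)
    (h₂ : NotOneClusterBits n) (h₃ : InfTwoBits n c₀) (h₄ : ∀ v, DeleteBits n v (c v)) :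
    Critical k L := by
  classical
  obtain ⟨g', hg'⟩ := hgs.hasRightInverse
  have hadj' : ∀ x y, L.Adj x y ↔ bitAdj n (g' x) (g' y) := fun x y => by rw [← hadj, hg', hg']
  have hinj : Function.Injective g' := hg'.injective
  -- Colour `0` marks the set `A`; shifting the nonzero colours down by one keeps them distinct.
  have hpred₃ : ∀ a : Fin 3, a ≠ 0 → ∀ b : Fin 3, b ≠ 0 →
      (Fin.predAbove (0 : Fin 2) a = Fin.predAbove (0 : Fin 2) b ↔ a = b) := by decide
  have hpred₄ : ∀ a : Fin 4, a ≠ 0 → ∀ b : Fin 4, b ≠ 0 →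
      (Fin.predAbove (0 : Fin 3) a = Fin.predAbove (0 : Fin 3) b ↔ a = b) := by decide
  refine ⟨?_, ?_, ?_, ?_⟩
  · rintro ⟨A, -, hA, hA'⟩
    rcases h₁ (fun i => g i ∈ A) with ⟨i, hi, l, hl, hil, j, hj, hij, hjl⟩ | ⟨i, hi, j, hj, hij, h⟩
    · simp only [decide_eq_true_eq, Bool.not_eq_true', ← Bool.not_eq_true, ← hadj] at *
      exact hA _ hi _ hj _ hl hij hjl hil
    · simp only [decide_eq_true_eq, Bool.not_eq_true', ← Bool.not_eq_true, ← hadj] at *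
      exact h (hA' _ trivial _ trivial hi hj (hgi.ne hij))
  · intro A f hA hf
    rcases h₂ (fun i => g i ∈ A) with ⟨i, hi, j, hj, hij⟩ | ⟨i, hi, j, hj, hij, l, hl, hil, hjl, h⟩
    · simp only [decide_eq_true_eq, ← hadj] at *
      exact hA _ hi _ hj hij
    · simp only [decide_eq_true_eq, Bool.not_eq_true', ← Bool.not_eq_true, ← hadj] at *
      have h1 := ((hf _ hi _ hj).1 hij).2
      have h2 := ((hf _ hj _ hl).1 hjl).2
      exact h ((hf _ hi _ hl).2 ⟨hgi.ne hil, h1.trans h2⟩)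
  · refine ⟨{x | c₀ (g' x) = 0}, fun x => Fin.predAbove 0 (c₀ (g' x)), ?_, ?_⟩
    · intro x hx y hy z hz hxy hyz hxz
      rw [hadj'] at hxy hyz hxz
      exact (h₃.1 _ (by simpa using hx) _ (by simpa using hy) _ (by simpa using hz) hxz).elim
        hxy hyz
    · intro x hx y hy
      rw [hadj', h₃.2 _ (by simpa using hx) _ (by simpa using hy), hinj.ne_iff,
        hpred₃ _ hx _ hy]
  · intro v
    have hne : ∀ x, x ≠ v → g' x ≠ g' v := fun x => hinj.ne
    rcases h₄ (g' v) with ⟨hA, hB⟩ | ⟨hA, hB⟩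
    · refine .inl ⟨{x | x ≠ v ∧ c (g' v) (g' x) = 0}, fun x hx => hx.1, ?_, ?_⟩
      · intro x hx y hy z hz hxy hyz hxz
        rw [hadj'] at hxy hyz hxz
        exact (hA _ (by simp [hx.2, hne x hx.1]) _ (by simp [hy.2, hne y hy.1]) _
          (by simp [hz.2, hne z hz.1]) hxz).elim hxy hyz
      · intro x hx y hy hx' hy' hxy
        have hx' : c (g' v) (g' x) ≠ 0 := fun h => hx' ⟨hx, h⟩
        have hy' : c (g' v) (g' y) ≠ 0 := fun h => hy' ⟨hy, h⟩
        rw [hadj']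
        exact hB _ (by simp [hx', hne x hx]) _ (by simp [hy', hne y hy]) (hinj.ne hxy)
    · refine .inr ⟨{x | c (g' v) (g' x) = 0},
        fun x => Fin.castLE hk (Fin.predAbove 0 (c (g' v) (g' x))), ?_, ?_⟩
      · intro x hx y hy
        rw [hadj']
        have hx₀ : c (g' v) (g' x) = 0 := hx.1
        have hy₀ : c (g' v) (g' y) = 0 := hy.1
        simpa using hA _ (by simp [hx₀, hne x hx.2]) _ (by simp [hy₀, hne y hy.2])
      · intro x hx y hy
        have hx₀ : c (g' v) (g' x) ≠ 0 := hx.1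
        have hy₀ : c (g' v) (g' y) ≠ 0 := hy.1
        rw [hadj', hB _ (by simp [hx₀, hne x hx.2]) _ (by simp [hy₀, hne y hy.2]), hinj.ne_iff,
          Fin.castLE_inj, hpred₄ _ hx.1 _ hy.1]

theorem critical_C4 {k : ℕ} (hk : 3 ≤ k) :
    Critical k (join (K 1) (C4 ⊕g copies 2 (K 1))) := by
  refine .of_bits hk 4435403262718 ![.inl 0, .inr (.inl 0), .inr (.inl 1), .inr (.inl 2), .inr (.inl 3),
    .inr (.inr (0, 0)), .inr (.inr (1, 0))]
    ![0, 0, 0, 0, 0, 1, 2]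
    ![![0, 0, 1, 0, 2, 0, 0], ![0, 0, 0, 1, 0, 0, 0], ![0, 0, 0, 0, 1, 0, 0],
      ![0, 1, 0, 0, 0, 0, 0], ![0, 0, 1, 0, 0, 0, 0], ![0, 0, 0, 0, 0, 0, 1],
      ![0, 0, 0, 0, 0, 1, 0]]
    ?_ ?_ ?_ ?_ ?_ ?_ ?_ <;> decide +kernel

theorem critical_twoP3 {k : ℕ} (hk : 3 ≤ k) :
    Critical k (join (K 1) (copies 2 P3)) := by
  refine .of_bits hk 147927542711038 ![.inl 0, .inr (0, 0), .inr (0, 1), .inr (0, 2), .inr (1, 0), .inr (1, 1),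
    .inr (1, 2)]
    ![0, 0, 1, 0, 0, 2, 0]
    ![![0, 0, 1, 0, 0, 2, 0], ![0, 0, 1, 1, 0, 0, 0], ![0, 0, 0, 0, 0, 1, 0],
      ![0, 1, 1, 0, 0, 0, 0], ![0, 0, 0, 0, 0, 1, 1], ![0, 0, 1, 0, 0, 0, 0],
      ![0, 0, 0, 0, 1, 1, 0]]
    ?_ ?_ ?_ ?_ ?_ ?_ ?_ <;> decide +kernel

theorem critical_compl_P3_K2 {k : ℕ} (hk : 3 ≤ k) :
    Critical k (join (K 1) (K 1 ⊕g (P3 ⊕g K 2)ᶜ)) := by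
  refine .of_bits hk 128567098491134 ![.inl 0, .inr (.inl 0), .inr (.inr (.inl 0)), .inr (.inr (.inl 1)),
    .inr (.inr (.inl 2)), .inr (.inr (.inr 0)), .inr (.inr (.inr 1))]
    ![0, 0, 1, 2, 1, 0, 0]
    ![![0, 0, 1, 2, 1, 0, 0], ![0, 0, 0, 0, 1, 0, 0], ![0, 1, 0, 0, 0, 0, 0],
      ![0, 0, 1, 0, 1, 0, 0], ![0, 1, 0, 0, 0, 0, 0], ![0, 0, 0, 0, 1, 0, 1],
      ![0, 0, 0, 0, 1, 1, 0]]
    ?_ ?_ ?_ ?_ ?_ ?_ ?_ <;> decide +kernel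

theorem critical_compl_P3_K1 {k : ℕ} (hk : 3 ≤ k) :
    Critical k (join (K 1) (K 2 ⊕g (P3 ⊕g K 1)ᶜ)) := by
  refine .of_bits hk 253214563812094 ![.inl 0, .inr (.inl 0), .inr (.inl 1), .inr (.inr (.inl 0)),
    .inr (.inr (.inl 1)), .inr (.inr (.inl 2)), .inr (.inr (.inr 0))]
    ![0, 0, 1, 0, 0, 2, 2]
    ![![0, 0, 1, 0, 0, 2, 2], ![0, 0, 0, 0, 0, 1, 1], ![0, 0, 0, 0, 0, 1, 1],
      ![0, 1, 1, 0, 0, 0, 0], ![0, 0, 0, 1, 0, 1, 1], ![0, 1, 1, 0, 0, 0, 0],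
      ![0, 1, 1, 2, 3, 2, 0]]
    ?_ ?_ ?_ ?_ ?_ ?_ ?_ <;> decide +kernel

theorem critical_K2_join {k : ℕ} (hk : 3 ≤ k) :
    Critical k (join (K 2) (K 1 ⊕g copies 2 (K 2))) := by
  refine .of_bits hk 156236723060478 ![.inl 0, .inl 1, .inr (.inl 0), .inr (.inr (0, 0)), .inr (.inr (0, 1)),
    .inr (.inr (1, 0)), .inr (.inr (1, 1))]
    ![0, 0, 0, 0, 1, 0, 2]
    ![![0, 0, 1, 2, 2, 3, 3], ![0, 0, 1, 2, 2, 3, 3], ![0, 0, 0, 0, 0, 1, 1],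
      ![0, 0, 0, 0, 0, 0, 1], ![0, 0, 0, 0, 0, 0, 1], ![0, 0, 0, 0, 1, 0, 0],
      ![0, 0, 0, 0, 1, 0, 0]]
    ?_ ?_ ?_ ?_ ?_ ?_ ?_ <;> decide +kernel

theorem critical_K1_K2_P3 {k : ℕ} (hk : 3 ≤ k) :
    Critical k (join (K 1) (K 1 ⊕g K 2 ⊕g P3)) := by
  refine .of_bits hk 147927542677758 ![.inl 0, .inr (.inl (.inl 0)), .inr (.inl (.inr 0)), .inr (.inl (.inr 1)),
    .inr (.inr 0), .inr (.inr 1), .inr (.inr 2)]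
    ![0, 0, 0, 1, 0, 2, 0]
    ![![0, 0, 0, 1, 0, 2, 0], ![0, 0, 1, 1, 0, 0, 0], ![0, 0, 0, 0, 0, 1, 0],
      ![0, 0, 0, 0, 0, 1, 0], ![0, 1, 2, 2, 0, 3, 3], ![0, 0, 0, 1, 0, 0, 0],
      ![0, 1, 2, 2, 3, 3, 0]]
    ?_ ?_ ?_ ?_ ?_ ?_ ?_ <;> decide +kernel

theorem critical_butterfly {k : ℕ} (hk : 3 ≤ k) :
    Critical k (join (K 1) (K 1 ⊕g join (K 1) (copies 2 (K 2)))) := by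
  refine .of_bits hk 165102078542078 ![.inl 0, .inr (.inl 0), .inr (.inr (.inl 0)), .inr (.inr (.inr (0, 0))),
    .inr (.inr (.inr (0, 1))), .inr (.inr (.inr (1, 0))), .inr (.inr (.inr (1, 1)))]
    ![0, 0, 0, 1, 1, 2, 2]
    ![![0, 0, 0, 1, 1, 2, 2], ![0, 0, 0, 0, 0, 1, 1], ![0, 1, 0, 2, 2, 3, 3],
      ![0, 0, 1, 0, 0, 0, 1], ![0, 0, 1, 0, 0, 0, 1], ![0, 0, 1, 0, 1, 0, 0],
      ![0, 0, 1, 0, 1, 0, 0]]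
    ?_ ?_ ?_ ?_ ?_ ?_ ?_ <;> decide +kernel

end

/-- Pigeonhole: `k - 1` singletons and two further cliques need `k + 1` colours. -/
theorem not_injective_of_two_missing {k : ℕ} (hk : 0 < k) {f : Fin (k - 1) → Fin k}
    (hf : Function.Injective f) {a b : Fin k} (ha : ∀ i, f i ≠ a) (hb : ∀ i, f i ≠ b)
    (hab : a ≠ b) : False := by
  have h := Finset.card_le_univ (insert a (insert b (Finset.univ.image f)))
  rw [Finset.card_insert_of_notMem (by simp [hab, ha]),
    Finset.card_insert_of_notMem (by simp [hb]), Finset.card_image_of_injective _ hf] at h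
  simp at h
  omega

@[simp] theorem copies_K1_adj {n : ℕ} (x y : Fin n × Fin 1) : ¬ (copies n (K 1)).Adj x y :=
  fun h => h.2 (Subsingleton.elim _ _)

theorem copies_K2_adj {n : ℕ} (x y : Fin n × Fin 2) :
    (copies n (K 2)).Adj x y ↔ x.1 = y.1 ∧ x.2 ≠ y.2 := Iff.rfl

theorem critical_fan {k : ℕ} (hk : 3 ≤ k) :
    Critical k (join (K 1) (copies (k - 1) (K 1) ⊕g copies 2 (K 2))) := by
  refine ⟨?_, ?_, ?_, ?_⟩
  · rintro ⟨A, -, hA, hA'⟩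
    have h0 : 0 < k - 1 := by omega
    have hS : ∀ p : Fin 2, ¬ (.inr (.inl (⟨0, h0⟩, 0)) ∈ A ∧ .inr (.inr (p, 0)) ∈ A ∧
        .inr (.inr (p, 1)) ∈ A) := fun p h => by
      simpa using hA _ h.2.1 _ h.1 _ h.2.2
    -- Already `K₁ + 2K₂` is not `(∞, 1)`-polar: the removed clique meets only one component,
    -- leaving a vertex and an edge from different components.
    have hE : ¬ ((.inr (.inr (0, 0)) ∈ A ∧ .inr (.inr (0, 1)) ∈ A) ∧ .inr (.inr (1, 0)) ∈ A) :=
      fun h => by simpa using hA _ h.1.1 _ h.2 _ h.1.2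
    have hout : ∀ q : Fin 2, .inr (.inl (⟨0, h0⟩, 0)) ∉ A → .inr (.inr (1, q)) ∉ A → False :=
      fun q h h' => by simpa using hA' _ trivial _ trivial h h'
    have hout' : ∀ q : Fin 2, .inr (.inl (⟨0, h0⟩, 0)) ∉ A → .inr (.inr (0, q)) ∉ A → False :=
      fun q h h' => by simpa using hA' _ trivial _ trivial h h'
    have hout'' : ∀ q q' : Fin 2, .inr (.inr (0, q)) ∉ A → .inr (.inr (1, q')) ∉ A → False :=
      fun q q' h h' => by simpa using hA' _ trivial _ trivial h h'
    grind
  · intro A f hA hf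
    by_cases hh : .inl 0 ∈ A
    · have hX : ∀ x, .inr x ∉ A := fun x hx => hA _ hh _ hx (join_adj_inl_inr _ _ _ _)
      have hf' : ∀ x y, x ≠ y → ¬ (copies (k - 1) (K 1) ⊕g copies 2 (K 2)).Adj x y →
          f (.inr x) ≠ f (.inr y) := by
        intro x y hxy hadj heq
        have := (hf _ (hX x) _ (hX y)).2 ⟨by simpa using hxy, heq⟩
        rw [join_adj_inr_inr] at this
        exact hadj this
      refine not_injective_of_two_missing (by omega) (f := fun i => f (.inr (.inl (i, 0))))
        (a := f (.inr (.inr (0, 0)))) (b := f (.inr (.inr (1, 0)))) ?_ ?_ ?_ ?_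
      · intro i j hij
        by_contra h
        exact hf' _ _ (by simpa using h) (by simp) hij
      all_goals intros; apply hf' <;> simp
    · have hE : ∀ p : Fin 2, ∃ q, .inr (.inr (p, q)) ∉ A := by
        intro p
        by_contra hcon
        push Not at hcon
        exact hA _ (hcon 0) _ (hcon 1) (by simp)
      obtain ⟨q, hq⟩ := hE 0
      obtain ⟨q', hq'⟩ := hE 1
      have h1 := ((hf _ hh _ hq).1 (join_adj_inl_inr _ _ _ _)).2
      have h2 := ((hf _ hh _ hq').1 (join_adj_inl_inr _ _ _ _)).2
      have := (hf _ hq _ hq').2 ⟨by simp, h1.symm.trans h2⟩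
      simp at this
  · refine ⟨{x | Sum.elim (fun _ => True) (Sum.elim (fun _ => True) fun _ => False) x},
      Sum.elim (fun _ => 0) (Sum.elim (fun _ => 0) fun y => y.1), ?_, ?_⟩
    · rintro (a | a | a) ha (b | b | b) hb (c | c | c) hc
      all_goals simp [eq_iff_true_of_subsingleton] at ha hb hc ⊢
    · rintro (a | a | a) ha (b | b | b) hb
      all_goals simp [copies_K2_adj, Prod.ext_iff, -copies_adj] at ha hb ⊢
      tauto
  · rintro (v | ⟨j, v⟩ | ⟨p, q⟩)
    · refine .inr ⟨{x | Sum.elim (fun _ => False) (Sum.elim (fun _ => True) fun _ => False) x},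
        Sum.elim (fun _ => ⟨0, by omega⟩) (Sum.elim (fun _ => ⟨0, by omega⟩)
          fun y => Fin.castLE (by omega) y.1), ?_, ?_⟩
      · rintro (a | a | a) ha (b | b | b) hb
        all_goals simp [eq_iff_true_of_subsingleton, -copies_adj] at ha hb ⊢
      · rintro (a | a | a) ha (b | b | b) hb
        all_goals simp [eq_iff_true_of_subsingleton, copies_K2_adj, Prod.ext_iff, -copies_adj]
          at ha hb ⊢
        tauto
    -- The two edges take the freed colour `j` and the last colour `k - 1`.
    · refine .inr ⟨{x | Sum.elim (fun _ => True) (fun _ => False) x},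
        Sum.elim (fun _ => ⟨0, by omega⟩) (Sum.elim (fun y => Fin.castLE (by omega) y.1)
          fun y => if y.1 = 0 then ⟨j, by omega⟩ else ⟨k - 1, by omega⟩), ?_, ?_⟩
      · rintro (a | a) ⟨ha, -⟩ (b | b) ⟨hb, -⟩
        all_goals simp [eq_iff_true_of_subsingleton] at ha hb ⊢
      · rintro (a | ⟨a, x⟩ | ⟨a, x⟩) ha (b | ⟨b, y⟩ | ⟨b, y⟩) hb
        all_goals simp [eq_iff_true_of_subsingleton, copies_K2_adj, Prod.ext_iff,
          -copies_adj] at ha hb ⊢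
        · split_ifs <;> simp only [Fin.ext_iff, Fin.val_castLE] at ha ⊢ <;> omega
        · split_ifs <;> simp only [Fin.ext_iff, Fin.val_castLE] at hb ⊢ <;> omega
        · have h1 := j.2.ne
          have h2 := j.2.ne'
          fin_cases a <;> fin_cases b <;> simp [h1, h2]
    -- The hub and the intact edge form the clique; everything else is independent.
    · refine .inl ⟨{x | Sum.elim (fun _ => False) (Sum.elim (fun _ => True)
        fun y => y.1 = p ∧ y.2 ≠ q) x}, ?_, ?_, ?_⟩
      · rintro (a | a | ⟨a, x⟩) ha
        all_goals simp at ha ⊢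
        tauto
      · rintro (a | a | ⟨a, x⟩) ha (b | b | ⟨b, y⟩) hb (c | c | ⟨c, z⟩) hc
        all_goals simp [copies_K2_adj, -copies_adj] at ha hb hc ⊢
        all_goals grind
      · rintro (a | a | ⟨a, x⟩) ha (b | b | ⟨b, y⟩) hb ha' hb' hab
        all_goals simp [eq_iff_true_of_subsingleton, copies_K2_adj, -copies_adj]
          at ha hb ha' hb' hab ⊢
        all_goals grind

/-! ### Adding `k - 1` isolated vertices to a critical graph -/

section
variable {W : Type*} {L : SimpleGraph W} {k : ℕ}

theorem Critical.not_polarOn (hk : 0 < k) (hL : Critical k L) :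
    ¬ PolarOn k (copies (k - 1) (K 1) ⊕g L) Set.univ := by
  rintro ⟨A, f, hA, hB⟩
  simp only [Set.univ_inter, ← Set.compl_eq_univ_sdiff] at hA hB
  by_cases hedge : ∃ a ∈ A, ∃ b ∈ A, (copies (k - 1) (K 1) ⊕g L).Adj a b
  · obtain ⟨a, ha, b, hb, hab⟩ := hedge
    have hl : ∀ i, .inl i ∉ A := by
      intro i hi
      refine hA a ha (.inl i) hi b hb ?_ ?_ hab
      · rcases a with a | a <;> simp [-copies_adj]
      · rcases b with b | b <;> simp [-copies_adj]
    refine hL.not_infOne ⟨Sum.inr ⁻¹' A, Set.subset_univ _, ?_, ?_⟩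
    · intro a ha b hb c hc hab hbc
      simpa using hA _ ha _ hb _ hc (by simpa using hab) (by simpa using hbc)
    · intro x _ y _ hx hy hxy
      by_contra hadj
      have hne : ∀ u v, u ∉ A → v ∉ A → u ≠ v → ¬ (copies (k - 1) (K 1) ⊕g L).Adj u v →
          f u ≠ f v := fun u v hu hv huv h h' => h ((hB u hu v hv).2 ⟨huv, h'⟩)
      refine not_injective_of_two_missing hk (f := fun i => f (.inl (i, 0)))
        (a := f (.inr x)) (b := f (.inr y)) ?_ ?_ ?_ ?_
      · intro i j hij
        by_contra h
        exact hne _ _ (hl _) (hl _) (by simpa using h) (by simp) hij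
      · exact fun i => hne _ _ (hl _) hx (by simp) (by simp)
      · exact fun i => hne _ _ (hl _) hy (by simp) (by simp)
      · exact hne _ _ hx hy (by simpa using hxy) (by simpa using hadj)
  · push Not at hedge
    refine hL.not_oneCluster (Sum.inr ⁻¹' A) (fun x => f (.inr x))
      (fun a ha b hb => by simpa using hedge _ ha _ hb) fun a ha b hb => ?_
    simpa using hB (.inr a) ha (.inr b) hb

theorem Critical.polarOn_compl (hk : 3 ≤ k) (hL : Critical k L)
    (v : Fin (k - 1) × Fin 1 ⊕ W) : PolarOn k (copies (k - 1) (K 1) ⊕g L) {v}ᶜ := by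
  rcases v with ⟨j, v⟩ | v
  · obtain ⟨A, f, hA, hB⟩ := hL.infTwo
    -- Deleting isolated vertex `j` frees its colour, so the two cliques of `infTwo` can use `j` and
    -- `k - 1`.
    refine ⟨{x | Sum.elim (fun _ => False) (fun y => y ∈ A) x},
      Sum.elim (fun y => Fin.castLE (by omega) y.1)
        fun y => if f y = 0 then ⟨j, by omega⟩ else ⟨k - 1, by omega⟩, ?_, ?_⟩
    · rintro (a | a) ⟨-, ha⟩ (b | b) ⟨-, hb⟩ (c | c) ⟨-, hc⟩
      all_goals simp at ha hb hc
      simpa using hA a ha b hb c hc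
    · rintro (⟨a, x⟩ | a) ⟨ha, ha'⟩ (⟨b, y⟩ | b) ⟨hb, hb'⟩
      all_goals simp [eq_iff_true_of_subsingleton, -copies_adj] at ha ha' hb hb' ⊢
      · split_ifs <;> simp only [Fin.ext_iff, Fin.val_castLE] at ha ⊢ <;> omega
      · split_ifs <;> simp only [Fin.ext_iff, Fin.val_castLE] at hb ⊢ <;> omega
      · rw [hB a ha' b hb']
        have h1 := j.2.ne
        have h2 := j.2.ne'
        generalize f a = p
        generalize f b = q
        fin_cases p <;> fin_cases q <;> simp [h1, h2]
  · rcases hL.delete v with ⟨A, hAv, hA, hB⟩ | ⟨A, f, hA, hB⟩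
    · refine ⟨{x | Sum.elim (fun _ => False) (fun y => y ∈ A) x},
        Sum.elim (fun y => Fin.castLE (by omega) y.1) fun _ => ⟨k - 1, by omega⟩, ?_, ?_⟩
      · rintro (a | a) ⟨-, ha⟩ (b | b) ⟨-, hb⟩ (c | c) ⟨-, hc⟩
        all_goals simp at ha hb hc
        simpa using hA a ha b hb c hc
      · rintro (⟨a, x⟩ | a) ⟨ha, ha'⟩ (⟨b, y⟩ | b) ⟨hb, hb'⟩
        all_goals simp [eq_iff_true_of_subsingleton, -copies_adj] at ha ha' hb hb' ⊢
        · simp only [Fin.ext_iff, Fin.val_castLE]; omega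
        · simp only [Fin.ext_iff, Fin.val_castLE]; omega
        · exact ⟨fun h => h.ne, hB a ha b hb ha' hb'⟩
    · refine ⟨{x | Sum.elim (fun _ => True) (fun y => y ∈ A) x},
        Sum.elim (fun y => ⟨0, by omega⟩) f, ?_, ?_⟩
      · rintro (a | a) ⟨ha', ha⟩ (b | b) ⟨hb', hb⟩ (c | c) ⟨hc', hc⟩
        all_goals simp [-copies_adj] at ha hb hc ha' hb' hc' ⊢
        all_goals intros; apply hA <;> simp [*]
      · rintro (a | a) ⟨ha, ha'⟩ (b | b) ⟨hb, hb'⟩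
        all_goals simp at ha ha' hb hb' ⊢
        exact hB a ⟨ha', ha⟩ b ⟨hb', hb⟩

end

/-! ### The listed graphs are cographs -/

theorem isCograph_bot (n : ℕ) : IsCograph (⊥ : SimpleGraph (Fin (n + 1))) := by
  have h1 : IsCograph (⊥ : SimpleGraph (Fin 1)) :=
    .iso ⟨(Equiv.ofUnique PUnit (Fin 1)), by simp⟩ .single
  induction n with
  | zero => exact h1
  | succ n ih =>
    refine .iso ⟨finSumFinEquiv, ?_⟩ (ih.sum h1)
    rintro (a | a) (b | b) <;> simp

theorem isCograph_K (n : ℕ) : IsCograph (K (n + 1)) := by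
  simpa [K] using (isCograph_bot n).compl

theorem IsCograph.join {V W : Type u} {G : SimpleGraph V} {H : SimpleGraph W} (hG : IsCograph G)
    (hH : IsCograph H) : IsCograph (join G H) := by
  refine .iso ⟨Equiv.refl _, ?_⟩ (hG.compl.sum hH.compl).compl
  rintro (a | a) (b | b)
  · have := G.ne_of_adj (a := a) (b := b)
    simp; tauto
  · simp
  · simp
  · have := H.ne_of_adj (a := a) (b := b)
    simp; tauto

theorem isCograph_copies_K1 (n : ℕ) : IsCograph (copies (n + 1) (K 1)) := by
  refine .iso ⟨(Equiv.prodUnique (Fin (n + 1)) (Fin 1)).symm, ?_⟩ (isCograph_bot n)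
  simp [-copies_adj]

theorem IsCograph.copies_two {V : Type} {G : SimpleGraph V} (hG : IsCograph G) :
    IsCograph (copies 2 G) := by
  refine .iso (H := copies 2 G) ⟨⟨Sum.elim (fun x => (0, x)) (fun x => (1, x)),
    fun x => if x.1 = 0 then .inl x.2 else .inr x.2, ?_, ?_⟩, ?_⟩ (hG.sum hG)
  · rintro (a | a) <;> simp
  · rintro ⟨i, a⟩
    fin_cases i <;> simp
  · rintro (a | a) (b | b) <;> simp

theorem isCograph_P3 : IsCograph P3 := by
  refine .iso (H := P3) ⟨⟨Sum.elim ![1] ![0, 2], ![.inr 0, .inl 0, .inr 1], ?_, ?_⟩, ?_⟩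
    ((isCograph_K 0).join (isCograph_bot 1))
  · decide
  · decide
  · intro a b
    revert a b
    decide

theorem isCograph_C4 : IsCograph C4 := by
  refine .iso (H := C4) ⟨⟨Sum.elim ![0, 2] ![1, 3], ![.inl 0, .inr 0, .inl 1, .inr 1], ?_, ?_⟩, ?_⟩
    ((isCograph_bot 1).join (isCograph_bot 1))
  · decide
  · decide
  · intro a b
    revert a b
    decide

/-- `IsCograph` stays within one universe, whereas the concrete graphs live in `Type` and `G` in an
arbitrary one. -/
theorem IsCograph.uLift {V : Type} {G : SimpleGraph V} (h : IsCograph G) :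
    IsCograph (G.comap (ULift.down : ULift.{v} V → V)) := by
  induction h with
  | single => exact .iso ⟨Equiv.ofUnique PUnit (ULift PUnit), by simp⟩ .single
  | compl _ ih =>
    refine .iso ⟨Equiv.refl _, ?_⟩ ih.compl
    simp
  | sum _ _ ihG ihH =>
    refine .iso ⟨⟨Sum.elim (fun x => ⟨.inl x.down⟩) (fun x => ⟨.inr x.down⟩),
      fun x => x.down.elim (fun y => .inl ⟨y⟩) (fun y => .inr ⟨y⟩), ?_, ?_⟩, ?_⟩ (ihG.sum ihH)
    · rintro (a | a) <;> rfl
    · rintro ⟨a | a⟩ <;> rfl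
    · rintro (a | a) (b | b) <;> simp
  | @iso V W G H e _ ih =>
    refine .iso ⟨Equiv.ulift.trans (e.toEquiv.trans Equiv.ulift.symm), ?_⟩ ih
    rintro ⟨a⟩ ⟨b⟩
    exact e.map_rel_iff

theorem IsCograph.of_iso {V : Type} {W : Type v} {G : SimpleGraph V} {H : SimpleGraph W}
    (h : IsCograph G) (e : G ≃g H) : IsCograph H :=
  .iso ⟨Equiv.ulift.trans e.toEquiv, e.map_rel_iff⟩ h.uLift

/-! ### Component types and isolated vertices -/

theorem hasComponentType_of_isolated {V : Type*} (G : SimpleGraph V) {n : ℕ} (ι : Fin n → V)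
    (hι : Function.Injective ι) (hiso : ∀ i v, ¬ G.Adj (ι i) v) {l m : V} (hl : G.Adj l m)
    (hcov : ∀ v, (∃ i, ι i = v) ∨ G.Reachable l v) : HasComponentType (n + 1) n G := by
  have hreach : ∀ i v, G.Walk (ι i) v → v = ι i := by
    intro i v w
    cases w with
    | nil => rfl
    | cons h _ => exact (hiso _ _ h).elim
  have hreach' : ∀ i v, G.connectedComponentMk v = G.connectedComponentMk (ι i) → v = ι i :=
    fun i v h => (SimpleGraph.ConnectedComponent.exact h.symm).elim (hreach i v)
  have hl' : ∀ i, l ≠ ι i := by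
    rintro i rfl
    exact hiso _ _ hl
  have hset : {C : G.ConnectedComponent | C.supp.encard = 1} =
      Set.range fun i => G.connectedComponentMk (ι i) := by
    ext C
    constructor
    · intro hC
      induction C using SimpleGraph.ConnectedComponent.ind with | _ x
      rcases hcov x with ⟨i, rfl⟩ | hx
      · exact ⟨i, rfl⟩
      · obtain ⟨z, hz⟩ := Set.encard_eq_one.1 hC
        have h1 : l ∈ (G.connectedComponentMk x).supp := SimpleGraph.ConnectedComponent.sound hx
        have h2 : m ∈ (G.connectedComponentMk x).supp :=
          SimpleGraph.ConnectedComponent.sound (hl.symm.reachable.trans hx)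
        rw [hz] at h1 h2
        exact (hl.ne (h1.trans h2.symm)).elim
    · rintro ⟨i, rfl⟩
      refine Set.encard_eq_one.2 ⟨ι i, ?_⟩
      ext x
      exact ⟨hreach' i x, fun h => by rw [h]; rfl⟩
  have hinj : Function.Injective fun i => G.connectedComponentMk (ι i) :=
    fun i j hij => hι (hreach' _ _ hij)
  refine ⟨?_, ?_⟩
  · let g : Option (Fin n) → G.ConnectedComponent :=
      fun o => o.elim (G.connectedComponentMk l) fun i => G.connectedComponentMk (ι i)
    have hg : Function.Bijective g := by
      constructor
      · rintro (_ | i) (_ | j) hij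
        · rfl
        · exact (hl' j (hreach' _ _ hij)).elim
        · exact (hl' i (hreach' _ _ hij.symm)).elim
        · exact congrArg some (hinj hij)
      · intro C
        induction C using SimpleGraph.ConnectedComponent.ind with | _ x
        rcases hcov x with ⟨i, rfl⟩ | hx
        · exact ⟨some i, rfl⟩
        · exact ⟨none, SimpleGraph.ConnectedComponent.sound hx⟩
    rw [← ENat.card_congr (Equiv.ofBijective g hg)]
    simp
  · rw [hset, ← Set.image_univ, hinj.encard_image]
    simp

theorem HasComponentType.exists_isolated {V : Type*} {G : SimpleGraph V} {n : ℕ}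
    (h : HasComponentType (n + 1) n G) : ∃ (ι : Fin n → V) (C : G.ConnectedComponent),
      Function.Injective ι ∧ (∀ i v, ¬ G.Adj (ι i) v) ∧ (∀ v, (∃ i, ι i = v) ↔ v ∉ C.supp) ∧
        C.supp.Nontrivial := by
  obtain ⟨h1, h2⟩ := h
  set T := {C : G.ConnectedComponent | C.supp.encard = 1} with hT
  have hfin : T.Finite := Set.finite_of_encard_eq_coe h2
  -- Of `n + 1` components `n` are trivial; cancelling `n` is allowed because it is finite.
  have hc : Tᶜ.encard = 1 := by
    have := Set.encard_add_encard_compl T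
    rw [Set.encard_univ, h1, h2] at this
    push_cast at this
    exact ENat.add_left_injective_of_ne_top (ENat.natCast_ne_top n) (by simpa [add_comm] using this)
  obtain ⟨C, hC⟩ := Set.encard_eq_one.1 hc
  have hTC : ∀ D, D ∈ T ↔ D ≠ C := fun D => by
    rw [← not_iff_not, not_not, ← Set.mem_compl_iff, hC]; rfl
  have := hfin.to_subtype
  have hcard : Nat.card T = n := by
    rw [Nat.card_coe_set_eq, Set.ncard, h2]; rfl
  let e : Fin n ≃ T := (finCongr hcard.symm).trans (Finite.equivFin T).symm
  have hsupp : ∀ D : T, ∃ x, D.1.supp = {x} := fun D => Set.encard_eq_one.1 D.2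
  choose r hr using hsupp
  have hrm : ∀ D : T, G.connectedComponentMk (r D) = D.1 := fun D => by
    have : r D ∈ D.1.supp := by rw [hr]; rfl
    exact this
  refine ⟨fun i => r (e i), C, ?_, ?_, ?_, ?_⟩
  · intro i j hij
    apply e.injective
    apply Subtype.ext
    rw [← hrm, ← hrm, show r (e i) = r (e j) from hij]
  · intro i v hv
    have : v ∈ (e i).1.supp := by
      rw [SimpleGraph.ConnectedComponent.mem_supp_iff, ← hrm]
      exact (SimpleGraph.ConnectedComponent.connectedComponentMk_eq_of_adj hv).symm
    rw [hr] at this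
    exact hv.ne this.symm
  · intro v
    rw [SimpleGraph.ConnectedComponent.mem_supp_iff, ← Ne, ← hTC]
    constructor
    · rintro ⟨i, rfl⟩
      rw [hrm]; exact (e i).2
    · intro hv
      refine ⟨e.symm ⟨_, hv⟩, ?_⟩
      have : v ∈ (G.connectedComponentMk v).supp := rfl
      rw [hr ⟨_, hv⟩] at this
      simpa using this.symm
  · have : C ∉ T := fun h => (hTC C).1 h rfl
    rw [← Set.one_lt_encard_iff_nontrivial]
    refine lt_of_le_of_ne ?_ fun h => this h.symm
    exact Set.one_le_encard_iff_nonempty.2 C.nonempty_supp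

/-! ### Passing between `G` and its nontrivial component -/

section
variable {V : Type*} {G : SimpleGraph V} {W : Type} {L : SimpleGraph W} {k : ℕ}

/-- An induced subgraph on a proper vertex subset would be polar, so the embedding must be onto. -/
theorem IsCographMinObstruction.iso_of_embedding {W : Type*} {L : SimpleGraph W} (hk : 0 < k)
    (hG : IsCographMinObstruction ⊤ (k : ℕ∞) G) (hL : ¬ PolarOn k L Set.univ) (f : L ↪g G) :
    Nonempty (G ≃g L) := by
  by_cases hf : Function.Surjective f
  · exact ⟨(RelIso.ofSurjective f hf).symm⟩
  · have h := (isPolar_induce_iff G _ hk).1 (hG.2.2 (Set.range f) (by rwa [Ne, Set.range_eq_univ]))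
    exact (hL (h.comap f fun x _ => ⟨x, rfl⟩)).elim

theorem isCographMinObstruction_of_critical (hk : 3 ≤ k) (hL : Critical k L) (hL' : IsCograph L)
    (e : G ≃g copies (k - 1) (K 1) ⊕g L) : IsCographMinObstruction ⊤ (k : ℕ∞) G := by
  have hk0 : 0 < k := by omega
  refine ⟨?_, ?_, ?_⟩
  · obtain ⟨n, rfl⟩ : ∃ n, k = n + 2 := ⟨k - 2, by omega⟩
    exact ((isCograph_copies_K1 n).sum hL').of_iso e.symm
  · rw [isPolar_iff _ hk0]
    exact fun h => hL.not_polarOn hk0 (h.comap e.symm.toEmbedding fun _ _ => trivial)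
  · intro S hS
    obtain ⟨v, hv⟩ := (Set.ne_univ_iff_exists_notMem S).1 hS
    rw [isPolar_induce_iff _ _ hk0]
    refine (hL.polarOn_compl hk (e v)).comap e.toEmbedding fun x hx h => hv ?_
    rwa [← e.injective (show e x = e v from h)]

theorem hasComponentType_of_join {m : ℕ} {W : Type} {X : SimpleGraph W} [Nonempty W] {n : ℕ}
    (e : G ≃g copies n (K 1) ⊕g join (K (m + 1)) X) : HasComponentType (n + 1) n G := by
  have hadj : ∀ x y, G.Adj (e.symm x) (e.symm y) ↔
      (copies n (K 1) ⊕g join (K (m + 1)) X).Adj x y := fun x y => e.symm.map_adj_iff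
  refine hasComponentType_of_isolated G (fun i => e.symm (.inl (i, 0))) ?_ ?_
    (l := e.symm (.inr (.inl 0))) (m := e.symm (.inr (.inr (Classical.arbitrary W)))) ?_ ?_
  · intro i j hij
    simpa using hij
  · intro i v
    obtain ⟨v, rfl⟩ := e.symm.surjective v
    rw [hadj]
    rcases v with v | v <;> simp [-copies_adj]
  · simp [hadj]
  · intro v
    obtain ⟨v, rfl⟩ := e.symm.surjective v
    rcases v with ⟨i, v⟩ | v | v
    · exact .inl ⟨i, by rw [Subsingleton.elim v 0]⟩
    · right
      by_cases hv : v = 0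
      · rw [hv]
      · exact ((hadj _ _).2 (by simpa using Ne.symm hv)).reachable
    · exact .inr ((hadj _ _).2 (by simp)).reachable

variable {ι : Fin (k - 1) → V} {S : Set V}

theorem not_infOneOn_of_not_polarOn (hk : 2 ≤ k) (hG : ¬ PolarOn k G Set.univ)
    (hι : Function.Injective ι) (hiso : ∀ i v, ¬ G.Adj (ι i) v)
    (hcov : ∀ v, (∃ i, ι i = v) ↔ v ∉ S) : ¬ InfOneOn (G.induce S) Set.univ := by
  classical
  rintro ⟨A, -, hA, hA'⟩
  have : Nonempty (Fin (k - 1)) := ⟨⟨0, by omega⟩⟩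
  obtain ⟨r, hr⟩ := hι.hasLeftInverse
  have hS : ∀ i, ι i ∉ S := fun i => (hcov _).1 ⟨i, rfl⟩
  -- The isolated vertices take the first `k - 1` colours, and the clique of `S` takes the last one.
  refine hG ⟨Subtype.val '' A, fun v => if v ∈ S then ⟨k - 1, by omega⟩ else
    Fin.castLE (by omega) (r v), ?_, ?_⟩
  · rintro _ ⟨-, a, ha, rfl⟩ _ ⟨-, b, hb, rfl⟩ _ ⟨-, c, hc, rfl⟩
    exact hA a ha b hb c hc
  · rintro a ⟨-, ha⟩ b ⟨-, hb⟩
    by_cases haS : a ∈ S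
    · by_cases hbS : b ∈ S
      · simp only [haS, hbS, if_true, and_true]
        exact ⟨fun h => h.ne, fun h => hA' ⟨a, haS⟩ trivial ⟨b, hbS⟩ trivial
          (fun h => ha ⟨_, h, rfl⟩) (fun h => hb ⟨_, h, rfl⟩) (by simpa using h)⟩
      · obtain ⟨j, rfl⟩ := (hcov b).2 hbS
        have := (r (ι j)).2.ne'
        simp [haS, hbS, G.adj_comm a, hiso, Fin.ext_iff, this]
    · obtain ⟨i, rfl⟩ := (hcov a).2 haS
      by_cases hbS : b ∈ S
      · have := (r (ι i)).2.ne
        simp [haS, hbS, hiso, Fin.ext_iff, this]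
      · obtain ⟨j, rfl⟩ := (hcov b).2 hbS
        simp only [hiso, haS, hbS, if_false, Fin.castLE_inj, hr i, hr j, false_iff, not_and]
        rintro h rfl
        exact h rfl

theorem not_oneCluster_of_not_polarOn (hG : ¬ PolarOn k G Set.univ) (hk : 0 < k)
    (hiso : ∀ i v, ¬ G.Adj (ι i) v) (hcov : ∀ v, (∃ i, ι i = v) ↔ v ∉ S) (A : Set S)
    (f : S → Fin k) (hA : ∀ a ∈ A, ∀ b ∈ A, ¬ (G.induce S).Adj a b) :
    ¬ ClusterOn (G.induce S) f Aᶜ := by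
  classical
  intro hf
  have hmem : ∀ v, v ∉ Subtype.val '' A ∪ Sᶜ → ∃ h : v ∈ S, (⟨v, h⟩ : S) ∉ A := by
    intro v hv
    have hvS : v ∈ S := by_contra fun h => hv (.inr h)
    exact ⟨hvS, fun h => hv (.inl ⟨_, h, rfl⟩)⟩
  -- Adding all isolated vertices keeps the set independent, hence complete multipartite.
  refine hG ⟨Subtype.val '' A ∪ Sᶜ, fun v => if h : v ∈ S then f ⟨v, h⟩ else ⟨0, hk⟩, ?_, ?_⟩
  · rintro a ⟨-, ha⟩ b - c ⟨-, hc⟩ - -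
    rcases ha with ⟨a, ha, rfl⟩ | ha
    · rcases hc with ⟨c, hc, rfl⟩ | hc
      · exact hA a ha c hc
      · obtain ⟨i, rfl⟩ := (hcov c).2 hc
        exact fun h => hiso _ _ h.symm
    · obtain ⟨i, rfl⟩ := (hcov a).2 ha
      exact hiso _ _
  · rintro a ⟨-, ha⟩ b ⟨-, hb⟩
    obtain ⟨haS, ha⟩ := hmem a ha
    obtain ⟨hbS, hb⟩ := hmem b hb
    simpa [haS, hbS] using hf _ ha _ hb

theorem connectedComponent_not_anticomplete (C : G.ConnectedComponent)
    {P Q : Set C.supp} (hP : P.Nonempty) (hQ : Q.Nonempty) (hPQ : P ∪ Q = Set.univ)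
    (h : ∀ p ∈ P, ∀ q ∈ Q, ¬ (G.induce C.supp).Adj p q) : ∃ x ∈ P, x ∈ Q := by
  by_contra hcon
  push Not at hcon
  have hclosed : ∀ x y : V, G.Walk x y → x ∈ Subtype.val '' P → y ∈ Subtype.val '' P := by
    intro x y w
    induction w with
    | nil => exact id
    | @cons x y z hxy _ ih =>
      rintro ⟨x, hx, rfl⟩
      have hy : y ∈ C.supp := C.mem_supp_of_adj_mem_supp x.2 hxy
      refine ih ⟨⟨y, hy⟩, ?_, rfl⟩
      have : (⟨y, hy⟩ : C.supp) ∈ P ∪ Q := hPQ ▸ trivial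
      exact this.resolve_right fun hq => h x hx _ hq hxy
  obtain ⟨p, hp⟩ := hP
  obtain ⟨q, hq⟩ := hQ
  obtain ⟨w⟩ := C.reachable_of_mem_supp p.2 q.2
  obtain ⟨q', hq', h'⟩ := hclosed _ _ w ⟨p, hp, rfl⟩
  exact hcon q (Subtype.ext h' ▸ hq') hq

end

end CographPolar

/-! ### The characterization -/

open CographPolar
theorem mainTheorem10 {V : Type*} [Finite V] (G : SimpleGraph V) (k : ℕ) (hk : 3 ≤ k) :
    (IsCographMinObstruction ⊤ (k : ℕ∞) G ∧ HasComponentType k (k - 1) G) ↔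
      ∃ (W : Type) (H : SimpleGraph W),
        (Nonempty (H ≃g join (K 1) (C4 ⊕g copies 2 (K 1))) ∨
          Nonempty (H ≃g join (K 1) (copies 2 P3)) ∨
          Nonempty (H ≃g join (K 1) (K 1 ⊕g (P3 ⊕g K 2)ᶜ)) ∨
          Nonempty (H ≃g join (K 1) (K 2 ⊕g (P3 ⊕g K 1)ᶜ)) ∨
          Nonempty (H ≃g join (K 2) (K 1 ⊕g copies 2 (K 2))) ∨
          Nonempty (H ≃g join (K 1) (K 1 ⊕g K 2 ⊕g P3)) ∨
          Nonempty (H ≃g join (K 1) (K 1 ⊕g join (K 1) (copies 2 (K 2)))) ∨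
          Nonempty (H ≃g join (K 1) (copies (k - 1) (K 1) ⊕g copies 2 (K 2)))) ∧
        Nonempty (G ≃g copies (k - 1) (K 1) ⊕g H) := by
  have hk0 : 0 < k := by omega
  constructor
  · rintro ⟨hG, hT⟩
    obtain ⟨ι, C, hι, hiso, hcov, hnt⟩ := HasComponentType.exists_isolated (n := k - 1)
      (by rwa [Nat.sub_add_cancel (by omega)])
    have hD := hG.1.decomposable
    have hnp : ¬ PolarOn k G Set.univ := fun h => hG.2.1 ((isPolar_iff G hk0).2 h)
    have hfin : ∀ {W : Type} {L : SimpleGraph W}, Critical k L →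
        (∃ S, EmbedsIn L (G.induce C.supp) S) →
        Nonempty (G ≃g copies (k - 1) (K 1) ⊕g L) := by
      rintro W L hL ⟨S, f, hfi, hfa, -⟩
      have hf : EmbedsIn L G C.supp :=
        ⟨fun x => f x, Subtype.val_injective.comp hfi, hfa, fun x => (f x).2⟩
      obtain ⟨g⟩ := ((embedsIn_copies_K1 hι fun i j => hiso i (ι j)).sum hf (by
        rintro _ ⟨i, rfl⟩ b hb
        exact ⟨fun h => (hcov _).1 ⟨i, rfl⟩ (h ▸ hb), hiso i b⟩)).nonempty
      exact hG.iso_of_embedding hk0 (hL.not_polarOn hk0) g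
    rcases exists_obstruction (hD.comap (SimpleGraph.Embedding.induce C.supp)) hk0
      (fun P Q hP hQ hd hPQ h => by
        obtain ⟨x, hx, hx'⟩ := connectedComponent_not_anticomplete C hP hQ hPQ h
        exact Set.disjoint_left.1 hd hx hx')
      (not_infOneOn_of_not_polarOn (by omega) hnp hι hiso hcov)
      (not_oneCluster_of_not_polarOn hnp hk0 hiso hcov) with h | h | h | h | h | h | h | h
    · exact ⟨_, _, .inl ⟨.refl⟩, hfin (critical_C4 hk) h⟩
    · exact ⟨_, _, .inr (.inl ⟨.refl⟩), hfin (critical_twoP3 hk) h⟩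
    · exact ⟨_, _, .inr (.inr (.inl ⟨.refl⟩)), hfin (critical_compl_P3_K2 hk) h⟩
    · exact ⟨_, _, .inr (.inr (.inr (.inl ⟨.refl⟩))), hfin (critical_compl_P3_K1 hk) h⟩
    · exact ⟨_, _, .inr (.inr (.inr (.inr (.inl ⟨.refl⟩)))), hfin (critical_K2_join hk) h⟩
    · exact ⟨_, _, .inr (.inr (.inr (.inr (.inr (.inl ⟨.refl⟩))))), hfin (critical_K1_K2_P3 hk) h⟩
    · exact ⟨_, _, .inr (.inr (.inr (.inr (.inr (.inr (.inl ⟨.refl⟩)))))),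
        hfin (critical_butterfly hk) h⟩
    · exact ⟨_, _, .inr (.inr (.inr (.inr (.inr (.inr (.inr ⟨.refl⟩)))))),
        hfin (critical_fan hk) h⟩
  · rintro ⟨W, H, hH, ⟨e⟩⟩
    -- Each listed graph is a join of `K₁` or `K₂` with a nonempty graph, hence connected with an
    -- edge; this gives the component type.
    have key : ∀ {W' : Type} {X : SimpleGraph W'} [Nonempty W'] {m : ℕ},
        Critical k (join (K (m + 1)) X) → IsCograph X → Nonempty (H ≃g join (K (m + 1)) X) →
        IsCographMinObstruction ⊤ (k : ℕ∞) G ∧ HasComponentType k (k - 1) G := by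
      rintro W' X _ m hL hX ⟨e'⟩
      have e'' := e.trans (SimpleGraph.Iso.sumCongr .refl e')
      refine ⟨isCographMinObstruction_of_critical hk hL ((isCograph_K m).join hX) e'', ?_⟩
      have := hasComponentType_of_join e''
      rwa [Nat.sub_add_cancel (by omega)] at this
    have hK1 := isCograph_K 0
    have hK2 := isCograph_K 1
    have h2K2 := hK2.copies_two
    rcases hH with h | h | h | h | h | h | h | h
    · exact key (m := 0) (critical_C4 hk) (isCograph_C4.sum hK1.copies_two) h
    · exact key (m := 0) (critical_twoP3 hk) isCograph_P3.copies_two h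
    · exact key (m := 0) (critical_compl_P3_K2 hk) (hK1.sum (isCograph_P3.sum hK2).compl) h
    · exact key (m := 0) (critical_compl_P3_K1 hk) (hK2.sum (isCograph_P3.sum hK1).compl) h
    · exact key (m := 1) (critical_K2_join hk) (hK1.sum h2K2) h
    · exact key (m := 0) (critical_K1_K2_P3 hk) ((hK1.sum hK2).sum isCograph_P3) h
    · exact key (m := 0) (critical_butterfly hk) (hK1.sum (hK1.join h2K2)) h
    · obtain ⟨n, rfl⟩ : ∃ n, k = n + 2 := ⟨k - 2, by omega⟩
      exact key (m := 0) (critical_fan hk) ((isCograph_copies_K1 n).sum h2K2) h
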